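/- Let $M$ be a connected smooth $n$-manifold without boundary and let a discrete group $G$ act on $M$ smoothly, freely, properly discontinuously and cocompactly. Fix a $G$-invariant Riemannian metric on $M$, with distance $d$ and Riemannian volume $\operatorname{vol}$. Let $E\to M$ be a smooth real vector bundle of finite rank with metric, together with a lift of the action of $G$ to $E$ by smooth fiberwise linear isometries (that is, $E$ is the lift of a vector bundle with metric over $M/G$). Let $K\subset M$ be a relatively compact Borel set with $M=\coprod_{g\in G}gK$ (for example, the union of one chosen lift of each open simplex of a triangulation of $M/G$). Let $\{e_i\}_{i\in I}$ be an orthonormal basis of $L^2(E|_K)$, and for $g\in G$ let $e_i^g=(g^{-1})^*e_i\in L^2(E|_{gK})\subset L^2(E)$. A bounded operator $A$ on $L^2(E)$ is called piecewise Hilbert-Schmidt if $g\mapsto\bigl(\sum_{i\in I}\|Ae_i^g\|^2\bigr)^{1/2}$ is a well-defined bounded function on $G$. A bounded operator $A$ is called piecewise trace-class if $A=B^*C$ for some piecewise Hilbert-Schmidt operators $B,C$; its piecewise trace is then the bounded function $\operatorname{Tr}(A)\colon G\to\mathbb{R}$, $\operatorname{Tr}(A)(g)=\sum_{i\in I}\langle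 Be_i^g,Ce_i^g\rangle$. Let $\operatorname{Gau}(E)$ be the set of bounded operators $A$ on $L^2(E)$ of the form $(Au)(x)=\int_M k_A(x,y)u(y)\operatorname{vol}(y)$ with a smooth section $k_A$ of $E^*\boxtimes E\to M\times M$ such that $|k_A(x,y)|\le C_1e^{-C_2d(x,y)^2}$ for all $x,y\in M$ and some constants $C_1,C_2>0$. Let $G$ act on the Banach space $\ell^\infty(G)$ of bounded real functions on $G$ by $(g\cdot\phi)(x)=\phi(xg)$, let $\mathcal{I}\subset\ell^\infty(G)$ be the linear subspace generated by the functions $\phi-g\cdot\phi$ with $g\in G$ and $\phi\in\ell^\infty(G)$, and let $\widehat{\mathcal{I}}$ be the closure of $\mathcal{I}$ in the $\ell^\infty$-norm. Then for all $A,B\in\operatorname{Gau}(E)$ the operators $AB$ and $BA$ are piecewise trace-class, and $$\operatorname{Tr}(AB)\equiv\operatorname{Tr}(BA)\mod\widehat{\mathcal{I}},$$ whatever decompositions $B_1^*C_1=AB$ and $B_2^*C_2=BA$ are used to compute the piecewise traces. -/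

import Mathlib

open MeasureTheory Bundle Set
open scoped Manifold ContDiff

noncomputable section

namespace PiecewiseTrace

/-! ### The Riemannian volume -/

section Volume

variable (n : ℕ) (M : Type*) [TopologicalSpace M] [ChartedSpace (EuclideanSpace ℝ (Fin n)) M]
  [RiemannianBundle (fun x : M => TangentSpace (𝓡 n) x)]

/-- The matrix `g_{ij} = ⟨∂_i, ∂_j⟩` of the Riemannian metric in the chart `e`, at the point of `M`
with coordinates `y`. -/
def gramMatrix (e : OpenPartialHomeomorph M (EuclideanSpace ℝ (Fin n)))
    (y : EuclideanSpace ℝ (Fin n)) : Matrix (Fin n) (Fin n) ℝ :=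
  Matrix.of fun i j =>
    inner ℝ (mfderiv (𝓡 n) (𝓡 n) e.symm y (EuclideanSpace.single i (1 : ℝ)))
      (mfderiv (𝓡 n) (𝓡 n) e.symm y (EuclideanSpace.single j (1 : ℝ)))

/-- The Riemannian volume of the domain of the chart `e`: the measure
`√(det g_{ij}) dy_1 ⋯ dy_n` on the target of `e`, carried over to `M`. -/
def chartVolume [MeasurableSpace M] (e : OpenPartialHomeomorph M (EuclideanSpace ℝ (Fin n))) :
    Measure M :=
  ((volume.restrict e.target).withDensity
    fun y => ENNReal.ofReal (Real.sqrt (gramMatrix n M e y).det)).map e.symm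

/-- The Riemannian volume of `M`. The measures `chartVolume` agree where two charts overlap, so
their supremum is the measure which restricts to `chartVolume` on the domain of each chart. -/
def riemannianVolume [MeasurableSpace M] : Measure M :=
  ⨆ x : M, chartVolume n M (chartAt (EuclideanSpace ℝ (Fin n)) x)

end Volume

/-! ### The Hilbert space of square integrable sections -/

section L2

variable {M : Type*} [TopologicalSpace M] [MeasurableSpace M]
  (F : Type*) [NormedAddCommGroup F] [NormedSpace ℝ F]
  (E : M → Type*) [TopologicalSpace (TotalSpace F E)] [∀ x, NormedAddCommGroup (E x)]
  [∀ x, InnerProductSpace ℝ (E x)] [FiberBundle F E]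
  (μ : Measure M)

/-- A section is measurable if it is so in every local trivialization (up to null sets). -/
def MeasurableSection (s : ∀ x, E x) : Prop :=
  ∀ x₀ : M, AEStronglyMeasurable (fun x => (trivializationAt F E x₀ ⟨x, s x⟩).2)
    (μ.restrict (trivializationAt F E x₀).baseSet)

/-- Square integrable sections. -/
def MemL2 (s : ∀ x, E x) : Prop :=
  MeasurableSection F E μ s ∧ ∫⁻ x, ‖s x‖ₑ ^ 2 ∂μ < ⊤

variable {F E μ}

theorem MeasurableSection.add [VectorBundle ℝ F E] [OpensMeasurableSpace M] {s t : ∀ x, E x}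
    (hs : MeasurableSection F E μ s) (ht : MeasurableSection F E μ t) :
    MeasurableSection F E μ (s + t) := by
  intro x₀
  refine ((hs x₀).add (ht x₀)).congr ?_
  filter_upwards [ae_restrict_mem (trivializationAt F E x₀).open_baseSet.measurableSet] with x hx
  exact (((trivializationAt F E x₀).linear ℝ hx).map_add (s x) (t x)).symm

theorem MeasurableSection.smul [VectorBundle ℝ F E] [OpensMeasurableSpace M] {s : ∀ x, E x}
    (c : ℝ) (hs : MeasurableSection F E μ s) : MeasurableSection F E μ (c • s) := by
  intro x₀
  refine ((hs x₀).const_smul c).congr ?_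
  filter_upwards [ae_restrict_mem (trivializationAt F E x₀).open_baseSet.measurableSet] with x hx
  exact (((trivializationAt F E x₀).linear ℝ hx).map_smul c (s x)).symm

theorem measurableSection_zero [VectorBundle ℝ F E] [OpensMeasurableSpace M] :
    MeasurableSection F E μ 0 := by
  intro x₀
  refine (aestronglyMeasurable_const (b := (0 : F))).congr ?_
  filter_upwards [ae_restrict_mem (trivializationAt F E x₀).open_baseSet.measurableSet] with x hx
  exact (((trivializationAt F E x₀).linear ℝ hx).map_zero).symm

theorem MemL2.smul [VectorBundle ℝ F E] [OpensMeasurableSpace M] {s : ∀ x, E x} (c : ℝ) (hs : MemL2 F E μ s) : MemL2 F E μ (c • s) := by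
  refine ⟨hs.1.smul c, ?_⟩
  have : ∀ x, ‖(c • s) x‖ₑ ^ 2 = ‖c‖ₑ ^ 2 * ‖s x‖ₑ ^ 2 := fun x => by
    rw [Pi.smul_apply, enorm_smul, mul_pow]
  rw [lintegral_congr this]
  rw [lintegral_const_mul' _ _ (by simp)]
  exact ENNReal.mul_lt_top (by simp) hs.2

variable [VectorBundle ℝ F E] [FiniteDimensional ℝ F] [IsContinuousRiemannianBundle F E]
  [SecondCountableTopology M] [OpensMeasurableSpace M]

theorem MeasurableSection.inner {s t : ∀ x, E x}
    (hs : MeasurableSection F E μ s) (ht : MeasurableSection F E μ t) :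
    AEStronglyMeasurable (fun x => inner ℝ (s x) (t x)) μ := by
  obtain ⟨T, hT, hcover⟩ := TopologicalSpace.isOpen_iUnion_countable
    (fun x₀ : M => (trivializationAt F E x₀).baseSet)
    (fun x₀ => (trivializationAt F E x₀).open_baseSet)
  have huniv : ⋃ x₀ ∈ T, (trivializationAt F E x₀).baseSet = univ := by
    rw [hcover]
    exact eq_univ_of_forall fun x => mem_iUnion.2 ⟨x, FiberBundle.mem_baseSet_trivializationAt' x⟩
  have : Countable T := hT.to_subtype
  rw [← Measure.restrict_univ (μ := μ), ← huniv, biUnion_eq_iUnion,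
    aestronglyMeasurable_iUnion_iff]
  rintro ⟨x₀, -⟩
  set e := trivializationAt F E x₀ with he
  let b := Module.finBasis ℝ F
  have hsec : ∀ a : F, ContinuousOn (fun x => (⟨x, e.symm x a⟩ : TotalSpace F E)) e.baseSet := by
    intro a
    have h := e.continuousOn_invFun.comp (f := fun x : M => (x, a)) (s := e.baseSet)
      (by fun_prop) (fun x hx => by simpa [e.mem_target] using hx)
    refine h.congr fun x hx => ?_
    exact e.mk_symm hx a
  have hcont : ∀ i j, ContinuousOn
      (fun x => (Inner.inner ℝ (e.symm x (b i)) (e.symm x (b j)) : ℝ)) e.baseSet := fun i j =>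
    (hsec (b i)).inner_bundle (hsec (b j))
  have hcoord : ∀ (u : ∀ x, E x), MeasurableSection F E μ u → ∀ i,
      AEStronglyMeasurable (fun x => b.coord i (e ⟨x, u x⟩).2) (μ.restrict e.baseSet) :=
    fun u hu i => (LinearMap.continuous_of_finiteDimensional (b.coord i)).comp_aestronglyMeasurable
      (hu x₀)
  have hmeas : AEStronglyMeasurable (fun x => ∑ i, ∑ j, (b.coord i (e ⟨x, s x⟩).2 *
      b.coord j (e ⟨x, t x⟩).2) * (Inner.inner ℝ (e.symm x (b i)) (e.symm x (b j)) : ℝ))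
      (μ.restrict e.baseSet) := by
    refine Finset.aestronglyMeasurable_fun_sum _ fun i _ =>
      Finset.aestronglyMeasurable_fun_sum _ fun j _ => ?_
    exact ((hcoord s hs i).mul (hcoord t ht j)).mul
      ((hcont i j).aestronglyMeasurable e.open_baseSet.measurableSet)
  refine hmeas.congr ?_
  filter_upwards [ae_restrict_mem e.open_baseSet.measurableSet] with x hx
  have hexp : ∀ u : E x, u = ∑ i, b.coord i (e ⟨x, u⟩).2 • e.symm x (b i) := by
    intro u
    have h1 : u = e.symmL ℝ x (e ⟨x, u⟩).2 := by
      rw [Trivialization.symmL_apply _ hx]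
      exact (e.symm_apply_apply_mk hx u).symm
    conv_lhs => rw [h1, ← b.sum_repr (e ⟨x, u⟩).2, map_sum]
    simp only [map_smul]
    simp only [Trivialization.symmL_apply _ hx, Module.Basis.coord_apply]
  conv_rhs => rw [hexp (s x), hexp (t x)]
  simp only [sum_inner, inner_sum, real_inner_smul_left, real_inner_smul_right]
  rw [Finset.sum_comm]
  exact Finset.sum_congr rfl fun i _ => Finset.sum_congr rfl fun j _ => by ring

theorem MemL2.integrable_inner {s t : ∀ x, E x} (hs : MemL2 F E μ s) (ht : MemL2 F E μ t) :
    Integrable (fun x => inner ℝ (s x) (t x)) μ := by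
  have key : ∀ {u : ∀ x, E x}, MemL2 F E μ u → MemLp (fun x => ‖u x‖) 2 μ := by
    intro u hu
    have hm : AEStronglyMeasurable (fun x => ‖u x‖) μ := by
      have := Real.continuous_sqrt.comp_aestronglyMeasurable (hu.1.inner hu.1)
      refine this.congr (Filter.Eventually.of_forall fun x => ?_)
      exact (norm_eq_sqrt_real_inner (u x)).symm
    refine ⟨hm, ?_⟩
    rw [eLpNorm_lt_top_iff_lintegral_rpow_enorm_lt_top (by norm_num) (by norm_num)]
    simpa using hu.2
  refine ((key hs).integrable_mul (key ht)).mono (hs.1.inner ht.1)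
    (Filter.Eventually.of_forall fun x => ?_)
  simpa using abs_real_inner_le_norm (s x) (t x)

theorem MemL2.add {s t : ∀ x, E x} (hs : MemL2 F E μ s) (ht : MemL2 F E μ t) :
    MemL2 F E μ (s + t) := by
  refine ⟨hs.1.add ht.1, ?_⟩
  have hfin : ∀ {u : ∀ x, E x}, MeasurableSection F E μ u →
      Integrable (fun x => inner ℝ (u x) (u x)) μ → ∫⁻ x, ‖u x‖ₑ ^ 2 ∂μ < ⊤ := by
    intro u _ hi
    have := hi.2
    rw [HasFiniteIntegral] at this
    refine lt_of_eq_of_lt (lintegral_congr fun x => ?_) this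
    rw [real_inner_self_eq_norm_sq, enorm_pow, enorm_norm]
  refine hfin (hs.1.add ht.1) ?_
  have := (((hs.integrable_inner hs).add (hs.integrable_inner ht)).add
    (ht.integrable_inner hs)).add (ht.integrable_inner ht)
  refine this.congr (Filter.Eventually.of_forall fun x => ?_)
  simp only [Pi.add_apply, inner_add_left, inner_add_right]
  ring

variable (F E μ)

/-- The vector space of square integrable sections (before identifying sections that agree almost
everywhere). -/
def sqIntegrableSections : Submodule ℝ (∀ x, E x) where
  carrier := {s | MemL2 F E μ s}
  add_mem' hs ht := hs.add ht
  zero_mem' := ⟨measurableSection_zero, by simp⟩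
  smul_mem' c _ hs := hs.smul c

/-- A copy of `sqIntegrableSections`, which carries the topology of the `L²`-seminorm. -/
def PreL2 : Type _ := sqIntegrableSections F E μ

instance : AddCommGroup (PreL2 F E μ) :=
  inferInstanceAs (AddCommGroup (sqIntegrableSections F E μ))

instance : Module ℝ (PreL2 F E μ) :=
  inferInstanceAs (Module ℝ (sqIntegrableSections F E μ))

variable {F E μ} in
/-- The section underlying an element of `PreL2`. -/
def PreL2.toSection (u : PreL2 F E μ) : ∀ x, E x := u.1

variable {F E μ} in
theorem PreL2.memL2 (u : PreL2 F E μ) : MemL2 F E μ u.toSection := u.2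

/-- The `L²`-inner product `⟨u, v⟩ = ∫ ⟨u(x), v(x)⟩`. -/
@[reducible] def preL2Core : PreInnerProductSpace.Core ℝ (PreL2 F E μ) where
  inner u v := ∫ x, inner ℝ (u.toSection x) (v.toSection x) ∂μ
  conj_inner_symm u v := by
    simp only [conj_trivial]
    exact integral_congr_ae (Filter.Eventually.of_forall fun x => real_inner_comm _ _)
  re_inner_nonneg u := by
    simp only [RCLike.re_to_real]
    exact integral_nonneg fun x => real_inner_self_nonneg
  add_left u v w := by
    rw [← integral_add (u.memL2.integrable_inner w.memL2) (v.memL2.integrable_inner w.memL2)]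
    exact integral_congr_ae (Filter.Eventually.of_forall fun x => inner_add_left _ _ _)
  smul_left u v c := by
    simp only [conj_trivial]
    rw [← integral_const_mul]
    exact integral_congr_ae (Filter.Eventually.of_forall fun x => real_inner_smul_left _ _ _)

instance : SeminormedAddCommGroup (PreL2 F E μ) :=
  @InnerProductSpace.Core.toSeminormedAddCommGroup ℝ _ _ _ _ (preL2Core F E μ)

instance : InnerProductSpace ℝ (PreL2 F E μ) :=
  InnerProductSpace.ofCore (preL2Core F E μ)

/-- The Hilbert space `L²(E)` of square integrable sections with respect to `μ`, two sections being
identified if their difference has norm zero, i.e. if they agree `μ`-almost everywhere. -/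
abbrev L2 : Type _ := SeparationQuotient (PreL2 F E μ)

variable {F E μ}

/-- A section representing an element of `L²(E)`; it is determined up to null sets. -/
def L2.rep (u : L2 F E μ) : ∀ x, E x := (Quotient.out u : PreL2 F E μ).toSection

variable (F μ) in
open Classical in
/-- The class in `L²(E)` of a square integrable section (and `0` for other sections). -/
def L2.ofSection (s : ∀ x, E x) : L2 F E μ :=
  if h : MemL2 F E μ s then SeparationQuotient.mk (⟨s, h⟩ : sqIntegrableSections F E μ) else 0

end L2

/-! ### The action of the group -/

section Action

variable (G : Type*) [Group G] {M : Type*} [MulAction G M]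

/-- A relatively compact Borel set `K` such that `M` is the disjoint union of its translates `gK`,
`g ∈ G`. -/
structure IsFundamentalPiece [TopologicalSpace M] [MeasurableSpace M] (K : Set M) : Prop where
  measurableSet : MeasurableSet K
  isCompact_closure : IsCompact (closure K)
  existsUnique_mem : ∀ x : M, ∃! g : G, x ∈ (fun y => g • y) '' K

/-- A lift of the action of `G` on `M` to a smooth action on the vector bundle `E` by fiberwise
linear isometries. For a free and properly discontinuous action this is the same thing as an
isomorphism of `E` with the pullback of a smooth vector bundle with metric over `M/G`. -/
structure EquivariantStructure (n : ℕ) [TopologicalSpace M]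
    [ChartedSpace (EuclideanSpace ℝ (Fin n)) M]
    (F : Type*) [NormedAddCommGroup F] [NormedSpace ℝ F]
    (E : M → Type*) [TopologicalSpace (TotalSpace F E)] [∀ x, NormedAddCommGroup (E x)]
    [∀ x, InnerProductSpace ℝ (E x)] [FiberBundle F E] where
  /-- The isometry from the fiber at `x` to the fiber at `g • x`. -/
  act : ∀ (g : G) (x : M), E x ≃ₗᵢ[ℝ] E (g • x)
  act_one : ∀ (x : M) (v : E x),
    (⟨(1 : G) • x, act 1 x v⟩ : TotalSpace F E) = ⟨x, v⟩
  act_mul : ∀ (g h : G) (x : M) (v : E x),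
    (⟨(g * h) • x, act (g * h) x v⟩ : TotalSpace F E) = ⟨g • h • x, act g (h • x) (act h x v)⟩
  contMDiff_act : ∀ g : G, ContMDiff ((𝓡 n).prod 𝓘(ℝ, F)) ((𝓡 n).prod 𝓘(ℝ, F)) ∞
    (fun p : TotalSpace F E => (⟨g • p.1, act g p.1 p.2⟩ : TotalSpace F E))

variable {G}
variable {n : ℕ} [TopologicalSpace M] [ChartedSpace (EuclideanSpace ℝ (Fin n)) M]
  {F : Type*} [NormedAddCommGroup F] [NormedSpace ℝ F]
  {E : M → Type*} [TopologicalSpace (TotalSpace F E)] [∀ x, NormedAddCommGroup (E x)]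
  [∀ x, InnerProductSpace ℝ (E x)] [FiberBundle F E]

open Classical in
/-- The section `(g⁻¹)^* s` over `gK`, extended by zero: its value at `x ∈ gK` is the vector of
`E x` that corresponds to `s (g⁻¹x)` under the isometry `E x ≃ E (g⁻¹x)`. -/
def EquivariantStructure.translate (ρ : EquivariantStructure G n F E) (K : Set M) (g : G)
    (s : ∀ x, E x) : ∀ x, E x :=
  fun x => if x ∈ (fun y => g • y) '' K then (ρ.act g⁻¹ x).symm (s (g⁻¹ • x)) else 0

end Action

/-! ### Piecewise Hilbert-Schmidt and piecewise trace-class operators -/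

section Operators

variable {n : ℕ} {M : Type*} [TopologicalSpace M] [ChartedSpace (EuclideanSpace ℝ (Fin n)) M]
  [SecondCountableTopology M] [MeasurableSpace M] [OpensMeasurableSpace M]
  {G : Type*} [Group G] [MulAction G M]
  {F : Type*} [NormedAddCommGroup F] [NormedSpace ℝ F] [FiniteDimensional ℝ F]
  {E : M → Type*} [TopologicalSpace (TotalSpace F E)] [∀ x, NormedAddCommGroup (E x)]
  [∀ x, InnerProductSpace ℝ (E x)] [FiberBundle F E] [VectorBundle ℝ F E]
  [IsContinuousRiemannianBundle F E]
  {μ : Measure M} (ρ : EquivariantStructure G n F E) {K : Set M}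
  {ι : Type*} (b : HilbertBasis ι ℝ (L2 F E (μ.restrict K)))

/-- The element `e_i^g = (g⁻¹)^* e_i` of `L²(E|_{gK}) ⊆ L²(E)`, for an orthonormal basis `(e_i)` of
`L²(E|_K)`. -/
def translatedBasis (g : G) (i : ι) : L2 F E μ :=
  L2.ofSection F μ (ρ.translate K g (b i).rep)

/-- `ρ₂(A)(g) = (∑_i ‖A e_i^g‖²)^{1/2}`. -/
def rhoTwo (A : L2 F E μ →L[ℝ] L2 F E μ) (g : G) : ℝ :=
  Real.sqrt (∑' i, ‖A (translatedBasis ρ b g i)‖ ^ 2)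

/-- `A` is piecewise Hilbert-Schmidt: `ρ₂(A)` is a well-defined bounded function on `G`. -/
def IsPiecewiseHilbertSchmidt (A : L2 F E μ →L[ℝ] L2 F E μ) : Prop :=
  (∀ g : G, Summable fun i => ‖A (translatedBasis ρ b g i)‖ ^ 2) ∧
    ∃ C : ℝ, ∀ g : G, rhoTwo ρ b A g ≤ C

/-- `A` is a piecewise trace-class operator with piecewise trace `τ ∈ ℓ^∞(G)`: there are piecewise
Hilbert-Schmidt operators `B` and `C` with `A = B^* C` and `τ(g) = ∑_i ⟨B e_i^g, C e_i^g⟩`. -/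
def HasPiecewiseTrace (A : L2 F E μ →L[ℝ] L2 F E μ) (τ : lp (fun _ : G => ℝ) ⊤) : Prop :=
  ∃ B C : L2 F E μ →L[ℝ] L2 F E μ,
    IsPiecewiseHilbertSchmidt ρ b B ∧ IsPiecewiseHilbertSchmidt ρ b C ∧
    (∀ u v : L2 F E μ, inner ℝ u (A v) = inner ℝ (B u) (C v)) ∧
    ∀ g : G, HasSum
      (fun i => (inner ℝ (B (translatedBasis ρ b g i)) (C (translatedBasis ρ b g i)) : ℝ)) (τ g)

end Operators

/-! ### Smoothing operators with Gaussian propagation -/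

section Gaussian

variable (n : ℕ) {M : Type*} [MetricSpace M] [ChartedSpace (EuclideanSpace ℝ (Fin n)) M]
  [SecondCountableTopology M] [MeasurableSpace M] [OpensMeasurableSpace M]
  (F : Type*) [NormedAddCommGroup F] [NormedSpace ℝ F]
  {E : M → Type*} [TopologicalSpace (TotalSpace F E)] [∀ x, NormedAddCommGroup (E x)]
  [∀ x, InnerProductSpace ℝ (E x)] [FiberBundle F E] [VectorBundle ℝ F E]

/-- `k` is a smooth section of the bundle `E^* ⊠ E` over `M × M`, with fiber `Hom(E_y, E_x)` at
`(x, y)`: it is smooth in local trivializations of `E`. -/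
def IsSmoothKernel (k : ∀ x y : M, E y →L[ℝ] E x) : Prop :=
  ∀ p₀ : M × M, ContMDiffAt ((𝓡 n).prod (𝓡 n)) 𝓘(ℝ, F →L[ℝ] F) ∞
    (fun p : M × M => ContinuousLinearMap.inCoordinates F E F E p₀.2 p.2 p₀.1 p.1 (k p.1 p.2)) p₀

variable {F} [FiniteDimensional ℝ F] [IsContinuousRiemannianBundle F E] {μ : Measure M}

/-- `A` is represented by the kernel function `k`: for `u ∈ L²(E)`, one has
`(Au)(x) = ∫ k(x,y) u(y) dμ(y)` (with a convergent integral) for almost every `x`. -/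
def IsRepresentedBy (A : L2 F E μ →L[ℝ] L2 F E μ) (k : ∀ x y : M, E y →L[ℝ] E x) : Prop :=
  ∀ u : L2 F E μ, ∀ᵐ x ∂μ, Integrable (fun y => k x y (u.rep y)) μ ∧
    (A u).rep x = ∫ y, k x y (u.rep y) ∂μ

/-- `A ∈ Gau(E)`: the operator `A` is smoothing, i.e. represented by a smooth kernel function `k`,
and `|k(x,y)| ≤ C₁ exp(-C₂ d(x,y)²)` for some `C₁, C₂ > 0`. -/
def HasGaussianPropagation (A : L2 F E μ →L[ℝ] L2 F E μ) : Prop :=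
  ∃ k : ∀ x y : M, E y →L[ℝ] E x, IsSmoothKernel n F k ∧ IsRepresentedBy A k ∧
    ∃ C₁ C₂ : ℝ, 0 < C₁ ∧ 0 < C₂ ∧ ∀ x y, ‖k x y‖ ≤ C₁ * Real.exp (-C₂ * dist x y ^ 2)

end Gaussian

/-! ### Coinvariants of bounded functions -/

section Coinvariants

variable (G : Type*) [Group G]

variable {G} in
/-- The action of `G` on `ℓ^∞(G)` given by `(g · φ)(x) = φ(xg)`. -/
def rightTranslate (g : G) (φ : lp (fun _ : G => ℝ) ⊤) : lp (fun _ : G => ℝ) ⊤ :=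
  ⟨fun x => φ (x * g), memℓp_infty (by
    obtain ⟨C, hC⟩ := memℓp_infty_iff.1 (lp.memℓp φ)
    exact ⟨C, by rintro _ ⟨x, rfl⟩; exact hC ⟨x * g, rfl⟩⟩)⟩

/-- The subspace of `ℓ^∞(G)` generated by the functions `φ - g · φ`. -/
def coinvariantSubspace : Submodule ℝ (lp (fun _ : G => ℝ) ⊤) :=
  Submodule.span ℝ {ψ | ∃ (g : G) (φ : lp (fun _ : G => ℝ) ⊤), ψ = φ - rightTranslate g φ}

end Coinvariants

end PiecewiseTrace

end

open PiecewiseTrace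

/-!
The translates `e_i^g` form an orthonormal basis of `L²(E)` indexed by `G × I`, so a bounded
operator is a block matrix indexed by `G × G`, the block `(h, g)` mapping `L²(E|_{gK})` to
`L²(E|_{hK})` (`translatedHilbertBasis`). For an operator with a Gaussian kernel, the Cauchy-Schwarz inequality
bounds the squared Hilbert-Schmidt norm of this block by a constant times the supremum of
`exp (-c * d²)` over `hK × gK` (`sum_sq_inner_translatedBasis_map_le`); this uses that all `gK` have
the same finite volume. As the action is cocompact and `M` is a length space, at most exponentially
many translates of `K` lie at a given distance from `K`, and therefore the bound has the form
`β (h⁻¹ * g)` with `β` summable (`IsFundamentalPiece.exists_summable_gaussian_bound`,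
`HasGaussianPropagation.exists_blockBound`).

Summing the blocks shows that such operators and their adjoints are piecewise Hilbert-Schmidt, so
`A ∘ B = (A†)† ∘ B` is piecewise trace-class. A piecewise trace is the sum of the diagonal matrix
coefficients over each piece, whatever the decomposition. Writing `φ g h` for the trace of the block
of `B` from `g` to `h` followed by the block of `A` from `h` to `g`, one gets
`Tr(AB)(g) = ∑ₕ φ g h` and, by the trace property for Hilbert-Schmidt operators,
`Tr(BA)(g) = ∑ₕ φ h g` (`hasSum_inner_comp`, `blockTrace_comm`). Substituting `h = g * s`
in the first sum and `h = g * s⁻¹` in the second, the difference becomes a series of terms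
`s · ψ - ψ` which converges in `ℓ^∞(G)` because `|φ g h| ≤ β (g⁻¹ * h)`
(`sub_mem_closure_coinvariantSubspace`).

Three facts about the geometric objects have to be established on the way: the Riemannian volume
is finite on compact sets and invariant under isometries (`chartVolume_preimage`, by the change of
variables formula), `L²(E)` is complete (so that adjoints exist), and the group acts by isometries
of the Riemannian distance.
-/

namespace PiecewiseTrace

/-! ### Distances on a Riemannian manifold -/

section Metric

variable {n : ℕ} {M : Type*} [MetricSpace M] [ChartedSpace (EuclideanSpace ℝ (Fin n)) M]
  [RiemannianBundle (fun x : M => TangentSpace (𝓡 n) x)]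
  [IsRiemannianManifold (𝓡 n) M]

/-- A smooth map which is infinitesimally isometric does not increase distances, since it preserves
the lengths of paths. -/
theorem edist_map_le {f : M → M} (hf : ContMDiff (𝓡 n) (𝓡 n) ∞ f)
    (hisom : ∀ (x : M) (v w : TangentSpace (𝓡 n) x),
      inner ℝ (mfderiv (𝓡 n) (𝓡 n) f x v) (mfderiv (𝓡 n) (𝓡 n) f x w) = inner ℝ v w) (x y : M) :
    edist (f x) (f y) ≤ edist x y := by
  rw [IsRiemannianManifold.out (I := 𝓡 n) x y]
  refine le_of_forall_gt fun r hr => ?_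
  obtain ⟨γ, h0, h1, hγ, hlen, -⟩ :=
    Manifold.exists_lt_locally_constant_of_riemannianEDist_lt hr zero_lt_one
  refine lt_of_le_of_lt ?_ hlen
  rw [IsRiemannianManifold.out (I := 𝓡 n)]
  have hf1 : ContMDiff (𝓡 n) (𝓡 n) 1 f := hf.of_le (by exact_mod_cast le_top)
  refine (Manifold.riemannianEDist_le_pathELength (γ := f ∘ γ) (hf1.comp hγ).contMDiffOn
    (by simp [h0]) (by simp [h1]) zero_le_one).trans (le_of_eq ?_)
  simp only [Manifold.pathELength_eq_lintegral_mfderiv_Icc]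
  refine lintegral_congr fun t => ?_
  rw [mfderiv_comp t ((hf1 _).mdifferentiableAt one_ne_zero)
    ((hγ t).mdifferentiableAt one_ne_zero)]
  have key : ∀ (x : M) (v : TangentSpace (𝓡 n) x), ‖mfderiv (𝓡 n) (𝓡 n) f x v‖ₑ = ‖v‖ₑ := by
    intro x v
    rw [enorm_eq_iff_norm_eq, norm_eq_sqrt_real_inner, norm_eq_sqrt_real_inner, hisom]
  exact key _ _

variable (n) in
/-- A Riemannian manifold is a length space: if `dist x y < a + b`, a point on an almost shortest
path from `x` to `y` splits the distance accordingly. -/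
theorem exists_dist_lt_dist_lt [IsManifold (𝓡 n) ∞ M] {x y : M} {a b : ℝ} (ha : 0 < a) (hb : 0 < b)
    (h : dist x y < a + b) : ∃ z, dist x z < a ∧ dist z y < b := by
  rcases lt_or_ge (dist x y) a with hlt | hge
  · exact ⟨y, hlt, by simpa using hb⟩
  have hr : Manifold.riemannianEDist (𝓡 n) x y < ENNReal.ofReal (a + b) := by
    rw [← IsRiemannianManifold.out (I := 𝓡 n) x y, edist_dist]
    exact (ENNReal.ofReal_lt_ofReal_iff (by positivity)).2 h
  obtain ⟨γ, h0, h1, hγ, hlen, -⟩ :=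
    Manifold.exists_lt_locally_constant_of_riemannianEDist_lt hr zero_lt_one
  set ℓ := Manifold.pathELength (𝓡 n) γ 0 1
  have hℓ : ℓ ≠ ⊤ := (hlen.trans ENNReal.ofReal_lt_top).ne
  have hℓ' : ℓ.toReal < a + b := by
    rwa [← ENNReal.ofReal_toReal hℓ, ENNReal.ofReal_lt_ofReal_iff (by positivity)] at hlen
  obtain ⟨s, hs1, hs2⟩ := exists_between (show max 0 (ℓ.toReal - b) < a by
    rw [max_lt_iff]; exact ⟨ha, by linarith⟩)
  obtain ⟨hs3, hs4⟩ := max_lt_iff.1 hs1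
  have hcont : ContinuousOn (fun t => dist x (γ t)) (Icc 0 1) :=
    (continuous_const.dist hγ.continuous).continuousOn
  obtain ⟨t, ht, hts⟩ := intermediate_value_Icc zero_le_one hcont
    (show s ∈ Icc _ _ by simp only [h0, h1, dist_self]; exact ⟨hs3.le, by linarith⟩)
  refine ⟨γ t, by simpa [hts] using hs2, ?_⟩
  have e1 : edist x (γ t) ≤ Manifold.pathELength (𝓡 n) γ 0 t := by
    rw [IsRiemannianManifold.out (I := 𝓡 n)]
    exact Manifold.riemannianEDist_le_pathELength hγ.contMDiffOn h0 rfl ht.1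
  have e2 : edist (γ t) y ≤ Manifold.pathELength (𝓡 n) γ t 1 := by
    rw [IsRiemannianManifold.out (I := 𝓡 n)]
    exact Manifold.riemannianEDist_le_pathELength hγ.contMDiffOn rfl h1 ht.2
  have e3 : edist x (γ t) + edist (γ t) y ≤ ℓ :=
    (add_le_add e1 e2).trans_eq (Manifold.pathELength_add ht.1 ht.2)
  have e4 := ENNReal.toReal_mono hℓ e3
  rw [ENNReal.toReal_add (edist_ne_top _ _) (edist_ne_top _ _), ← dist_edist, ← dist_edist] at e4
  simp only at hts
  linarith

end Metric

/-! ### Growth of the group, and summability of Gaussians -/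

section Growth

theorem summable_pow_mul_exp_neg_sq (N : ℕ) {c : ℝ} (hc : 0 < c) :
    Summable fun m : ℕ => (N : ℝ) ^ (m + 1) * Real.exp (-c * (m : ℝ) ^ 2) := by
  have hexp : Summable fun m : ℕ => Real.exp ((N : ℝ) + (N + 1) ^ 2 / (4 * c)) *
      Real.exp (-(m : ℝ)) := Real.summable_exp_neg_nat.mul_left _
  refine Summable.of_nonneg_of_le (fun m => by positivity) (fun m => ?_) hexp
  have h1 : (N : ℝ) ^ (m + 1) ≤ Real.exp (N * (m + 1)) := by
    have : (N : ℝ) ≤ Real.exp N := by linarith [Real.add_one_le_exp (N : ℝ)]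
    calc (N : ℝ) ^ (m + 1) ≤ Real.exp N ^ (m + 1) := by gcongr
      _ = _ := by rw [← Real.exp_nat_mul]; push_cast; ring_nf
  have h2 : ((N : ℝ) + 1) * m - c * m ^ 2 ≤ (N + 1) ^ 2 / (4 * c) := by
    rw [le_div_iff₀ (by positivity)]
    nlinarith [sq_nonneg ((N : ℝ) + 1 - 2 * c * m)]
  calc (N : ℝ) ^ (m + 1) * Real.exp (-c * (m : ℝ) ^ 2)
      ≤ Real.exp (N * (m + 1)) * Real.exp (-c * (m : ℝ) ^ 2) := by gcongr
    _ ≤ _ := by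
      rw [← Real.exp_add, ← Real.exp_add, Real.exp_le_exp]
      linarith

open scoped Pointwise in
open Classical in
/-- The Švarc-Milnor argument: there is a finite set `S ⊆ G` such that a translate `gK` which
comes within distance `r * (m + 1)` of `K` has `g` in the product set `S ^ (m + 1)`. -/
theorem IsFundamentalPiece.exists_finset_pow {M G : Type*} [MetricSpace M] [LocallyCompactSpace M]
    [MeasurableSpace M] [Group G] [MulAction G M] [ProperlyDiscontinuousSMul G M] {K : Set M}
    (hK : IsFundamentalPiece G K)
    (hmid : ∀ (x y : M) (a b : ℝ), 0 < a → 0 < b → dist x y < a + b →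
      ∃ z, dist x z < a ∧ dist z y < b)
    (hiso : ∀ (g : G) (x y : M), dist (g • x) (g • y) = dist x y) :
    ∃ (S : Finset G) (r : ℝ), 0 < r ∧ ∀ (m : ℕ) (g : G) (x y : M), x ∈ K → y ∈ K →
      dist x (g • y) < r * (m + 1) → g ∈ S ^ (m + 1) := by
  obtain ⟨r, hr, hL⟩ := hK.isCompact_closure.exists_isCompact_cthickening
  have hfin := ProperlyDiscontinuousSMul.finite_disjoint_inter_image (Γ := G) hL hL
  have hmem : ∀ (g : G) (x y : M), x ∈ K → y ∈ K → dist x (g • y) < r → g ∈ hfin.toFinset := by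
    intro g x y hx hy hd
    rw [Set.Finite.mem_toFinset]
    refine ⟨g • y, ⟨y, Metric.self_subset_cthickening _ (subset_closure hy), rfl⟩, ?_⟩
    exact Metric.mem_cthickening_of_dist_le _ x _ _ (subset_closure hx)
      (by rw [dist_comm]; exact hd.le)
  refine ⟨hfin.toFinset, r, hr, fun m => ?_⟩
  induction m with
  | zero => intro g x y hx hy hd; simpa using hmem g x y hx hy (by simpa using hd)
  | succ m ih =>
    intro g x y hx hy hd
    obtain ⟨z, hxz, hzy⟩ := hmid x (g • y) r (r * (m + 1)) hr (by positivity)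
      (by push_cast at hd; linarith)
    obtain ⟨h, ⟨z', hz', rfl⟩, -⟩ := hK.existsUnique_mem z
    have h1 := hmem h x z' hx hz' hxz
    have h2 : h⁻¹ * g ∈ hfin.toFinset ^ (m + 1) := by
      refine ih _ z' y hz' hy ?_
      rw [← hiso h, smul_smul, mul_inv_cancel_left]
      exact hzy
    rw [pow_succ', ← mul_inv_cancel_left h g]
    exact Finset.mul_mem_mul h1 h2

open scoped Pointwise in
open Classical in
/-- On `hK × gK` the Gaussian `exp (-c * d²)` is dominated by a summable function of `h⁻¹ * g`,
because there are at most exponentially many translates of `K` at a given distance from `K`. -/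
theorem IsFundamentalPiece.exists_summable_gaussian_bound {M G : Type*} [MetricSpace M]
    [LocallyCompactSpace M] [MeasurableSpace M] [Group G] [MulAction G M]
    [ProperlyDiscontinuousSMul G M] {K : Set M} (hK : IsFundamentalPiece G K)
    (hmid : ∀ (x y : M) (a b : ℝ), 0 < a → 0 < b → dist x y < a + b →
      ∃ z, dist x z < a ∧ dist z y < b)
    (hiso : ∀ (g : G) (x y : M), dist (g • x) (g • y) = dist x y) {c : ℝ} (hc : 0 < c) :
    ∃ β : G → ℝ, Summable β ∧ (∀ g, 0 ≤ β g) ∧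
      ∀ g h : G, ∀ x ∈ K, ∀ y ∈ K,
        Real.exp (-c * dist (h • x) (g • y) ^ 2) ≤ β (h⁻¹ * g) := by
  obtain ⟨S, r, hr, hS⟩ := hK.exists_finset_pow hmid hiso
  -- `β s = ∑ₘ f (m, s)` contains the term `exp (-c * (r * m) ^ 2)` as soon as `s ∈ S ^ (m + 1)`
  set a : ℕ → ℝ := fun m => Real.exp (-(c * r ^ 2) * (m : ℝ) ^ 2) with ha
  set f : ℕ × G → ℝ := fun p => if p.2 ∈ S ^ (p.1 + 1) then a p.1 else 0 with hf
  have hf0 : 0 ≤ f := fun p => by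
    simp only [hf]; split_ifs
    · exact (Real.exp_pos _).le
    · exact le_rfl
  have hsum : Summable f := by
    rw [summable_prod_of_nonneg hf0]
    constructor
    · intro m
      refine summable_of_ne_finset_zero (s := S ^ (m + 1)) fun g hg => ?_
      simp only [hf, if_neg hg]
    · refine Summable.of_nonneg_of_le (fun m => tsum_nonneg fun g => hf0 _) (fun m => ?_)
        (summable_pow_mul_exp_neg_sq S.card (show 0 < c * r ^ 2 by positivity))
      rw [tsum_eq_sum (s := S ^ (m + 1)) fun g hg => by simp only [hf, if_neg hg]]
      rw [Finset.sum_congr rfl fun g hg => (by simp only [hf, if_pos hg] : f (m, g) = a m),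
        Finset.sum_const, nsmul_eq_mul]
      have : ((S ^ (m + 1)).card : ℝ) ≤ (S.card : ℝ) ^ (m + 1) := by
        exact_mod_cast Finset.card_pow_le
      gcongr
  have hsum' : Summable fun p : G × ℕ => f p.swap := hsum.comp_injective Prod.swap_injective
  refine ⟨fun g => ∑' m, f (m, g), hsum'.prod, fun g => tsum_nonneg fun m => hf0 _, ?_⟩
  intro g h x hx y hy
  set d := dist (h • x) (g • y)
  have hd : d = dist x ((h⁻¹ * g) • y) := by
    rw [← hiso h x, smul_smul, mul_inv_cancel_left]
  have hd0 : 0 ≤ d := dist_nonneg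
  set m := ⌊d / r⌋₊
  have hm1 : r * m ≤ d := by
    have := Nat.floor_le (show 0 ≤ d / r by positivity)
    rwa [le_div_iff₀ hr, mul_comm] at this
  have hm2 : d < r * (m + 1) := by
    have := Nat.lt_floor_add_one (d / r)
    rwa [div_lt_iff₀ hr, mul_comm] at this
  have hmem : h⁻¹ * g ∈ S ^ (m + 1) := hS m _ x y hx hy (by rwa [← hd])
  have hle : f (m, h⁻¹ * g) ≤ ∑' m, f (m, h⁻¹ * g) :=
    (hsum'.prod_factor (h⁻¹ * g)).le_tsum m fun k _ => hf0 _
  refine le_trans ?_ hle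
  simp only [hf, if_pos hmem, ha]
  rw [Real.exp_le_exp]
  have : (r * m) ^ 2 ≤ d ^ 2 := by gcongr
  nlinarith

end Growth

/-! ### Operators given by block matrices -/

section Blocks

variable {G ι H : Type*} [NormedAddCommGroup H] [InnerProductSpace ℝ H]

theorem hasSum_sq_inner_hilbertBasis {κ : Type*} (e : HilbertBasis κ ℝ H) (u : H) :
    HasSum (fun p => (inner ℝ (e p) u : ℝ) ^ 2) (‖u‖ ^ 2) := by
  have := e.hasSum_inner_mul_inner u u
  rw [real_inner_self_eq_norm_sq] at this
  refine this.congr_fun fun p => ?_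
  rw [sq, real_inner_comm u]

/-- The trace of the composition of the block of `B` from `g` to `h` with the block of `A` from `h`
to `g`, as the sum of the products of matrix coefficients. -/
noncomputable def blockTrace (e : HilbertBasis (G × ι) ℝ H) (A B : H →L[ℝ] H) (g h : G) : ℝ :=
  ∑' p : ι × ι, inner ℝ (e (g, p.1)) (A (e (h, p.2))) * inner ℝ (e (h, p.2)) (B (e (g, p.1)))

theorem blockTrace_comm (e : HilbertBasis (G × ι) ℝ H) (A B : H →L[ℝ] H) (g h : G) :
    blockTrace e A B g h = blockTrace e B A h g := by
  unfold blockTrace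
  rw [← (Equiv.prodComm ι ι).tsum_eq]
  exact tsum_congr fun p => mul_comm _ _

variable [Group G]

/-- The block of `A` from the `g`-th to the `h`-th summand, with respect to an orthonormal basis
indexed by `G × ι`, has squared Hilbert-Schmidt norm at most `β (h⁻¹ * g)`.
The bound is imposed on the finite partial sums, which makes summability a consequence. -/
def BlockBound (e : HilbertBasis (G × ι) ℝ H) (β : G → ℝ) (A : H →L[ℝ] H) : Prop :=
  ∀ (g h : G) (s t : Finset ι),
    ∑ j ∈ t, ∑ i ∈ s, (inner ℝ (e (h, j)) (A (e (g, i))) : ℝ) ^ 2 ≤ β (h⁻¹ * g)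

variable {e : HilbertBasis (G × ι) ℝ H} {β : G → ℝ} {A B : H →L[ℝ] H}

theorem BlockBound.mono {β' : G → ℝ} (hA : BlockBound e β A) (h : ∀ g, β g ≤ β' g) :
    BlockBound e β' A :=
  fun g g' s t => (hA g g' s t).trans (h _)

theorem BlockBound.sum_sq_le (hA : BlockBound e β A) (g h : G) (s : Finset (ι × ι)) :
    ∑ p ∈ s, (inner ℝ (e (h, p.2)) (A (e (g, p.1))) : ℝ) ^ 2 ≤ β (h⁻¹ * g) := by
  classical
  refine le_trans ?_ (hA g h (s.image Prod.fst) (s.image Prod.snd))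
  rw [Finset.sum_comm, ← Finset.sum_product']
  refine Finset.sum_le_sum_of_subset_of_nonneg (fun p hp => ?_) fun _ _ _ => sq_nonneg _
  exact Finset.mem_product.2 ⟨Finset.mem_image_of_mem _ hp, Finset.mem_image_of_mem _ hp⟩

theorem BlockBound.summable_sq (hA : BlockBound e β A) (g h : G) :
    Summable fun p : ι × ι => (inner ℝ (e (h, p.2)) (A (e (g, p.1))) : ℝ) ^ 2 :=
  summable_of_sum_le (fun _ => sq_nonneg _) (hA.sum_sq_le g h)

theorem BlockBound.tsum_sq_le (hA : BlockBound e β A) (g h : G) :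
    ∑' p : ι × ι, (inner ℝ (e (h, p.2)) (A (e (g, p.1))) : ℝ) ^ 2 ≤ β (h⁻¹ * g) :=
  (hA.summable_sq g h).tsum_le_of_sum_le (hA.sum_sq_le g h)

/-- The blocks of `A` starting at `g` together form a Hilbert-Schmidt operator, of squared norm at
most `∑ β`. -/
theorem BlockBound.sum_norm_sq_le (hA : BlockBound e β A) (hβ : Summable β) (g : G)
    (s : Finset ι) : ∑ i ∈ s, ‖A (e (g, i))‖ ^ 2 ≤ ∑' h, β h := by
  have h1 : HasSum (fun p : G × ι => ∑ i ∈ s, (inner ℝ (e p) (A (e (g, i))) : ℝ) ^ 2)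
      (∑ i ∈ s, ‖A (e (g, i))‖ ^ 2) :=
    hasSum_sum fun i _ => hasSum_sq_inner_hilbertBasis e (A (e (g, i)))
  rw [← h1.tsum_eq, h1.summable.tsum_prod]
  let σ : G ≃ G := (Equiv.inv G).trans (Equiv.mulRight g)
  rw [← σ.tsum_eq β]
  refine h1.summable.prod.tsum_le_tsum (fun h => ?_) (σ.summable_iff.2 hβ)
  exact (h1.summable.prod_factor h).tsum_le_of_sum_le (hA g h s)

theorem BlockBound.summable_norm_sq (hA : BlockBound e β A) (hβ : Summable β) (g : G) :
    Summable fun i => ‖A (e (g, i))‖ ^ 2 :=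
  summable_of_sum_le (fun _ => sq_nonneg _) (hA.sum_norm_sq_le hβ g)

theorem BlockBound.tsum_norm_sq_le (hA : BlockBound e β A) (hβ : Summable β) (g : G) :
    ∑' i, ‖A (e (g, i))‖ ^ 2 ≤ ∑' h, β h :=
  (hA.summable_norm_sq hβ g).tsum_le_of_sum_le (hA.sum_norm_sq_le hβ g)

theorem BlockBound.summable_column (hA : BlockBound e β A) (hβ : Summable β) (g : G) :
    Summable fun q : ι × G × ι => (inner ℝ (e q.2) (A (e (g, q.1))) : ℝ) ^ 2 := by
  have h := fun i => hasSum_sq_inner_hilbertBasis e (A (e (g, i)))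
  refine (summable_prod_of_nonneg fun _ => sq_nonneg _).2 ⟨fun i => (h i).summable, ?_⟩
  exact (hA.summable_norm_sq hβ g).congr fun i => (h i).tsum_eq.symm

theorem BlockBound.adjoint [CompleteSpace H] (hA : BlockBound e β A)
    (hsymm : ∀ g, β g⁻¹ = β g) : BlockBound e β (ContinuousLinearMap.adjoint A) := by
  intro g h s t
  rw [Finset.sum_comm]
  refine (le_of_eq ?_).trans ((hA h g t s).trans (le_of_eq ?_))
  · refine Finset.sum_congr rfl fun i _ => Finset.sum_congr rfl fun j _ => ?_
    rw [ContinuousLinearMap.adjoint_inner_right, real_inner_comm]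
  · rw [← hsymm]; group

theorem abs_blockTrace_le (hA : BlockBound e β A) (hB : BlockBound e β B)
    (hsymm : ∀ g, β g⁻¹ = β g) (g h : G) : |blockTrace e A B g h| ≤ β (g⁻¹ * h) := by
  have ha : Summable fun p : ι × ι => (inner ℝ (e (g, p.1)) (A (e (h, p.2))) : ℝ) ^ 2 :=
    (Equiv.prodComm ι ι).summable_iff.2 (hA.summable_sq h g)
  have ha' : ∑' p : ι × ι, (inner ℝ (e (g, p.1)) (A (e (h, p.2))) : ℝ) ^ 2 ≤ β (g⁻¹ * h) := by
    rw [← (Equiv.prodComm ι ι).tsum_eq]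
    exact hA.tsum_sq_le h g
  have hb := hB.summable_sq g h
  have hb' : _ ≤ β (g⁻¹ * h) := (hB.tsum_sq_le g h).trans_eq (by rw [← hsymm]; group)
  have hab := (ha.add hb).mul_left (1 / 2)
  rw [← Real.norm_eq_abs]
  refine (tsum_of_norm_bounded (a := _) hab.hasSum fun p => ?_).trans ?_
  · rw [Real.norm_eq_abs, abs_mul]
    nlinarith [sq_nonneg (|(inner ℝ (e (g, p.1)) (A (e (h, p.2))) : ℝ)| -
      |(inner ℝ (e (h, p.2)) (B (e (g, p.1))) : ℝ)|),
      sq_abs (inner ℝ (e (g, p.1)) (A (e (h, p.2))) : ℝ),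
      sq_abs (inner ℝ (e (h, p.2)) (B (e (g, p.1))) : ℝ)]
  · rw [tsum_mul_left, ha.tsum_add hb]
    linarith

/-- The diagonal matrix coefficients of `A ∘ B` over the `g`-th summand sum up to the sum of the
block traces. -/
theorem hasSum_inner_comp [CompleteSpace H] (hA : BlockBound e β A) (hB : BlockBound e β B)
    (hβ : Summable β) (hsymm : ∀ g, β g⁻¹ = β g) (g : G) :
    HasSum (fun i => (inner ℝ (e (g, i)) (A (B (e (g, i)))) : ℝ)) (∑' h, blockTrace e A B g h) := by
  set F : ι × G × ι → ℝ := fun q =>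
    inner ℝ (e (g, q.1)) (A (e q.2)) * inner ℝ (e q.2) (B (e (g, q.1))) with hF
  have hsum : Summable F := by
    have ha := (hA.adjoint hsymm).summable_column hβ g
    have hb := hB.summable_column hβ g
    refine Summable.of_norm_bounded (ha.add hb) fun q => ?_
    simp only [hF, ContinuousLinearMap.adjoint_inner_right, Real.norm_eq_abs, abs_mul]
    rw [real_inner_comm (A (e q.2))]
    nlinarith [sq_nonneg (|(inner ℝ (A (e q.2)) (e (g, q.1)) : ℝ)| -
      |(inner ℝ (e q.2) (B (e (g, q.1))) : ℝ)|),
      sq_abs (inner ℝ (A (e q.2)) (e (g, q.1)) : ℝ),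
      sq_abs (inner ℝ (e q.2) (B (e (g, q.1))) : ℝ),
      sq_nonneg (inner ℝ (A (e q.2)) (e (g, q.1)) : ℝ),
      sq_nonneg (inner ℝ (e q.2) (B (e (g, q.1))) : ℝ)]
  have h1 : HasSum (fun i => (inner ℝ (e (g, i)) (A (B (e (g, i)))) : ℝ)) (∑' q, F q) := by
    refine hsum.hasSum.prod_fiberwise fun i => ?_
    have := e.hasSum_inner_mul_inner (ContinuousLinearMap.adjoint A (e (g, i))) (B (e (g, i)))
    simpa only [ContinuousLinearMap.adjoint_inner_left] using this
  let σ : G × ι × ι ≃ ι × G × ι :=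
    { toFun := fun q => (q.2.1, q.1, q.2.2)
      invFun := fun q => (q.2.1, q.1, q.2.2)
      left_inv := fun _ => rfl
      right_inv := fun _ => rfl }
  have h2 : ∑' q, F q = ∑' h, blockTrace e A B g h := by
    rw [← σ.tsum_eq F]
    refine (σ.summable_iff.2 hsum).tsum_prod.trans ?_
    rfl
  rwa [h2] at h1

end Blocks

/-! ### Coinvariants of bounded functions -/

section Coinvariants

variable {G : Type*} [Group G]

theorem norm_rightTranslate_le (g : G) (φ : lp (fun _ : G => ℝ) ⊤) :
    ‖rightTranslate g φ‖ ≤ ‖φ‖ :=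
  lp.norm_le_of_forall_le (norm_nonneg _) fun _ => lp.norm_apply_le_norm ENNReal.top_ne_zero φ _

/-- The row sums and the column sums of a matrix with summable off-diagonal decay agree modulo the
closure of the coinvariant subspace: with `ψ s g = φ (g * s⁻¹) g`, their difference is the
norm-convergent series `∑ₛ (s · ψ s - ψ s)`. -/
theorem sub_mem_closure_coinvariantSubspace {β : G → ℝ} (hβ : Summable β) {φ : G → G → ℝ}
    (hφ : ∀ g h, |φ g h| ≤ β (g⁻¹ * h)) {τ₁ τ₂ : lp (fun _ : G => ℝ) ⊤}
    (h₁ : ∀ g, τ₁ g = ∑' h, φ g h) (h₂ : ∀ g, τ₂ g = ∑' h, φ h g) :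
    τ₁ - τ₂ ∈ (coinvariantSubspace G).topologicalClosure := by
  have hb : ∀ s g : G, ‖φ (g * s⁻¹) g‖ ≤ β s := fun s g =>
    (hφ _ _).trans_eq (by congr 1; group)
  let ψ : G → lp (fun _ : G => ℝ) ⊤ := fun s =>
    ⟨fun g => φ (g * s⁻¹) g, memℓp_infty ⟨β s, by rintro _ ⟨g, rfl⟩; exact hb s g⟩⟩
  have hψ : ∀ s, ‖ψ s‖ ≤ β s := fun s =>
    lp.norm_le_of_forall_le ((norm_nonneg _).trans (hb s 1)) (hb s)
  have hsum : Summable fun s => rightTranslate s (ψ s) - ψ s := by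
    refine Summable.of_norm_bounded (hβ.add hβ) fun s => (norm_sub_le _ _).trans ?_
    exact add_le_add ((norm_rightTranslate_le _ _).trans (hψ s)) (hψ s)
  have key : τ₁ - τ₂ = ∑' s, (rightTranslate s (ψ s) - ψ s) := by
    ext g
    have h3 : HasSum (fun s => φ g (g * s) - φ (g * s⁻¹) g)
        ((∑' s, (rightTranslate s (ψ s) - ψ s) : lp (fun _ : G => ℝ) ⊤) g) := by
      have := hsum.hasSum.mapL (lp.evalCLM ℝ (fun _ : G => ℝ) ⊤ g)
      refine this.congr_fun fun s => ?_
      change _ = φ (g * s * s⁻¹) (g * s) - φ (g * s⁻¹) g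
      rw [mul_inv_cancel_right]
    have h4 : Summable fun s => φ g (g * s) := Summable.of_norm_bounded hβ fun s =>
      (hφ _ _).trans_eq (by congr 1; group)
    have h5 : Summable fun s => φ (g * s⁻¹) g := Summable.of_norm_bounded hβ fun s => hb s g
    rw [← h3.tsum_eq, h4.tsum_sub h5]
    change τ₁ g - τ₂ g = _
    rw [h₁, h₂, ← (Equiv.mulLeft g).tsum_eq (φ g),
      ← ((Equiv.inv G).trans (Equiv.mulLeft g)).tsum_eq fun h => φ h g]
    rfl
  rw [key]
  refine (Submodule.isClosed_topologicalClosure _).mem_of_tendsto hsum.hasSum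
    (Filter.Eventually.of_forall fun T => Submodule.sum_mem _ fun s _ => ?_)
  rw [← neg_sub]
  exact Submodule.neg_mem _ (Submodule.le_topologicalClosure _
    (Submodule.subset_span ⟨s, ψ s, rfl⟩))

end Coinvariants

/-! ### The Riemannian volume -/

section RiemannianVolume

theorem measurableSet_inter_preimage_of_continuousOn {X Y : Type*} [TopologicalSpace X]
    [MeasurableSpace X] [OpensMeasurableSpace X] [TopologicalSpace Y] [MeasurableSpace Y]
    [BorelSpace Y] {f : X → Y} {s : Set X} (hf : ContinuousOn f s) (hs : MeasurableSet s)
    {t : Set Y} (ht : MeasurableSet t) : MeasurableSet (s ∩ f ⁻¹' t) := by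
  have h : MeasurableSet (s.domRestrict f ⁻¹' t) :=
    (continuousOn_iff_continuous_domRestrict.1 hf).measurable ht
  have h' := hs.subtype_image h
  rwa [Set.domRestrict_eq, Set.preimage_comp, Subtype.image_preimage_coe] at h'

theorem inner_sum_smul_eq_mul_apply {n : ℕ} {V : Type*} [NormedAddCommGroup V]
    [InnerProductSpace ℝ V] (L : EuclideanSpace ℝ (Fin n) →L[ℝ] V) (J : Matrix (Fin n) (Fin n) ℝ)
    (i j : Fin n) :
    inner ℝ (L (∑ k, J k i • EuclideanSpace.single k (1 : ℝ)))
        (L (∑ k, J k j • EuclideanSpace.single k (1 : ℝ))) =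
      (J.transpose * (Matrix.of fun k l => (inner ℝ (L (EuclideanSpace.single k 1))
        (L (EuclideanSpace.single l 1)) : ℝ)) * J) i j := by
  simp only [map_sum, map_smul, sum_inner, inner_sum, Matrix.mul_apply, Matrix.transpose_apply,
    Finset.sum_mul, Matrix.of_apply]
  refine Finset.sum_congr rfl fun k _ => Finset.sum_congr rfl fun l _ => ?_
  rw [real_inner_smul_left, real_inner_smul_right]
  ring

variable {n : ℕ} {M : Type*} [TopologicalSpace M] [ChartedSpace (EuclideanSpace ℝ (Fin n)) M]
  [RiemannianBundle (fun x : M => TangentSpace (𝓡 n) x)]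

/-- The tangent spaces are all the model space, with an inner product depending on the point. -/
theorem inner_tangentSpace_congr {p q : M} (h : p = q) (v w : EuclideanSpace ℝ (Fin n)) :
    (inner ℝ (show TangentSpace (𝓡 n) p from v) (show TangentSpace (𝓡 n) p from w) : ℝ) =
      inner ℝ (show TangentSpace (𝓡 n) q from v) (show TangentSpace (𝓡 n) q from w) := by
  subst h; rfl

/-- The Gram matrices in two charts are related by the Jacobian matrix of the coordinate expression
`T` of an infinitesimally isometric map `f`. -/
theorem sqrt_det_gramMatrix_eq {f : M → M}
    (hisom : ∀ (x : M) (v w : TangentSpace (𝓡 n) x),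
      inner ℝ (mfderiv (𝓡 n) (𝓡 n) f x v) (mfderiv (𝓡 n) (𝓡 n) f x w) = inner ℝ v w)
    {e e' : OpenPartialHomeomorph M (EuclideanSpace ℝ (Fin n))}
    {y : EuclideanSpace ℝ (Fin n)} {T : EuclideanSpace ℝ (Fin n) → EuclideanSpace ℝ (Fin n)}
    (hT : DifferentiableAt ℝ T y) (hf : MDifferentiableAt (𝓡 n) (𝓡 n) f (e.symm y))
    (he : MDifferentiableAt (𝓡 n) (𝓡 n) e.symm y)
    (he' : MDifferentiableAt (𝓡 n) (𝓡 n) e'.symm (T y))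
    (hcomm : ∀ᶠ z in nhds y, e'.symm (T z) = f (e.symm z)) :
    Real.sqrt (gramMatrix n M e y).det =
      |(fderiv ℝ T y).det| * Real.sqrt (gramMatrix n M e' (T y)).det := by
  have h0 : e'.symm (T y) = f (e.symm y) := hcomm.self_of_nhds
  -- the chain rule for the two sides of `e'.symm ∘ T = f ∘ e.symm`
  have hD : ∀ v : EuclideanSpace ℝ (Fin n),
      (mfderiv (𝓡 n) (𝓡 n) e'.symm (T y) (fderiv ℝ T y v) : EuclideanSpace ℝ (Fin n)) =
        mfderiv (𝓡 n) (𝓡 n) f (e.symm y) (mfderiv (𝓡 n) (𝓡 n) e.symm y v) := by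
    intro v
    have h1 : (mfderiv (𝓡 n) (𝓡 n) (e'.symm ∘ T) y v : EuclideanSpace ℝ (Fin n)) =
        mfderiv (𝓡 n) (𝓡 n) (f ∘ e.symm) y v := by
      have : (e'.symm ∘ T) =ᶠ[nhds y] (f ∘ e.symm) := hcomm
      rw [this.mfderiv_eq]
      rfl
    rw [mfderiv_comp y he' hT.mdifferentiableAt, mfderiv_comp y hf he, mfderiv_eq_fderiv] at h1
    exact h1
  let J : Matrix (Fin n) (Fin n) ℝ :=
    LinearMap.toMatrix (EuclideanSpace.basisFun (Fin n) ℝ).toBasis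
      (EuclideanSpace.basisFun (Fin n) ℝ).toBasis (fderiv ℝ T y : _ →ₗ[ℝ] _)
  have hJ : ∀ i, fderiv ℝ T y (EuclideanSpace.single i 1) =
      ∑ k, J k i • EuclideanSpace.single k (1 : ℝ) := by
    intro i
    conv_lhs => rw [← (EuclideanSpace.basisFun (Fin n) ℝ).sum_repr
      (fderiv ℝ T y (EuclideanSpace.single i 1))]
    refine Finset.sum_congr rfl fun k _ => ?_
    simp [J, LinearMap.toMatrix_apply]
  have hgram : gramMatrix n M e y = J.transpose * gramMatrix n M e' (T y) * J := by
    ext i j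
    have h2 : gramMatrix n M e y i j =
        inner ℝ (mfderiv (𝓡 n) (𝓡 n) e'.symm (T y) (fderiv ℝ T y (EuclideanSpace.single i 1)))
          (mfderiv (𝓡 n) (𝓡 n) e'.symm (T y) (fderiv ℝ T y (EuclideanSpace.single j 1))) := by
      refine (hisom _ _ _).symm.trans ?_
      refine (inner_tangentSpace_congr h0.symm _ _).trans ?_
      rw [← hD, ← hD]
    rw [h2, hJ, hJ]
    exact inner_sum_smul_eq_mul_apply (V := TangentSpace (𝓡 n) (e'.symm (T y))) _ J i j
  have hdet : J.det = (fderiv ℝ T y).det := LinearMap.det_toMatrix _ _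
  rw [hgram, Matrix.det_mul, Matrix.det_mul, Matrix.det_transpose, ← hdet,
    show J.det * (gramMatrix n M e' (T y)).det * J.det =
      J.det ^ 2 * (gramMatrix n M e' (T y)).det by ring,
    Real.sqrt_mul (sq_nonneg _), Real.sqrt_sq_eq_abs]

theorem continuousOn_gramMatrix_det [IsManifold (𝓡 n) ∞ M]
    [IsContMDiffRiemannianBundle (𝓡 n) ∞ (EuclideanSpace ℝ (Fin n))
      (fun x : M => TangentSpace (𝓡 n) x)] (x : M) :
    ContinuousOn (fun y => (gramMatrix n M (chartAt (EuclideanSpace ℝ (Fin n)) x) y).det)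
      (chartAt (EuclideanSpace ℝ (Fin n)) x).target := by
  set e := chartAt (EuclideanSpace ℝ (Fin n)) x with he
  have : IsContinuousRiemannianBundle (EuclideanSpace ℝ (Fin n))
      (fun x : M => TangentSpace (𝓡 n) x) := by
    obtain ⟨g, hg, h⟩ := IsContMDiffRiemannianBundle.exists_contMDiff (IB := 𝓡 n) (n := ∞)
      (F := EuclideanSpace ℝ (Fin n)) (E := fun x : M => TangentSpace (𝓡 n) x)
    exact ⟨g, hg.continuous, h⟩
  have hsec : ∀ v : EuclideanSpace ℝ (Fin n), ContinuousOn
      (fun y => (⟨e.symm y, mfderiv (𝓡 n) (𝓡 n) e.symm y v⟩ : TangentBundle (𝓡 n) M))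
      e.target := by
    intro v
    have h1 : ContMDiffOn (𝓡 n) (𝓡 n) ∞ e.symm e.target := contMDiffOn_chart_symm
    have h2 := h1.continuousOn_tangentMapWithin (by simp) e.open_target.uniqueMDiffOn
    have h3 : Continuous fun y : EuclideanSpace ℝ (Fin n) =>
        (⟨y, v⟩ : TangentBundle (𝓡 n) (EuclideanSpace ℝ (Fin n))) := by
      have := (tangentBundleModelSpaceHomeomorph (𝓡 n)).symm.continuous.comp
        (show Continuous fun y : EuclideanSpace ℝ (Fin n) =>
          ((y, v) : ModelProd (EuclideanSpace ℝ (Fin n)) (EuclideanSpace ℝ (Fin n))) from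
          (continuous_id.prodMk continuous_const : _))
      exact this
    refine (h2.comp h3.continuousOn (fun y hy => hy)).congr fun y hy => ?_
    simp only [Function.comp_apply, tangentMapWithin]
    rw [mfderivWithin_of_isOpen e.open_target hy]
  have hentry : ∀ i j, ContinuousOn (fun y => gramMatrix n M e y i j) e.target := fun i j =>
    (hsec _).inner_bundle (hsec _)
  simp only [Matrix.det_apply]
  fun_prop

variable [MeasurableSpace M] [BorelSpace M]

theorem chartVolume_apply (e : OpenPartialHomeomorph M (EuclideanSpace ℝ (Fin n)))
    {S : Set M} (hS : MeasurableSet S) :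
    chartVolume n M e S = ∫⁻ y in e.target ∩ e.symm ⁻¹' S,
      ENNReal.ofReal (Real.sqrt (gramMatrix n M e y).det) := by
  have hm : AEMeasurable e.symm ((volume.restrict e.target).withDensity
      fun y => ENNReal.ofReal (Real.sqrt (gramMatrix n M e y).det)) :=
    (e.continuousOn_symm.aemeasurable e.open_target.measurableSet).mono_ac
      (withDensity_absolutelyContinuous _ _)
  rw [chartVolume, Measure.map_apply_of_aemeasurable hm hS, withDensity_apply',
    Measure.restrict_restrict' e.open_target.measurableSet, inter_comm]

theorem chartVolume_source_inter (e : OpenPartialHomeomorph M (EuclideanSpace ℝ (Fin n)))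
    {S : Set M} (hS : MeasurableSet S) :
    chartVolume n M e (S ∩ e.source) = chartVolume n M e S := by
  rw [chartVolume_apply e hS, chartVolume_apply e (hS.inter e.open_source.measurableSet)]
  congr 2
  ext y
  simp only [mem_inter_iff, mem_preimage]
  exact ⟨fun h => ⟨h.1, h.2.1⟩, fun h => ⟨h.1, h.2, e.map_target h.1⟩⟩

/-- The charts `x` and `x'` compute the same volume for a set and its preimage under an
infinitesimally isometric diffeomorphism `f`. For `f = id` this says that the volumes computed in
different charts agree. -/
theorem chartVolume_preimage [IsManifold (𝓡 n) ∞ M] (f : M ≃ₜ M)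
    (hf : ContMDiff (𝓡 n) (𝓡 n) ∞ f)
    (hisom : ∀ (x : M) (v w : TangentSpace (𝓡 n) x),
      inner ℝ (mfderiv (𝓡 n) (𝓡 n) f x v) (mfderiv (𝓡 n) (𝓡 n) f x w) = inner ℝ v w)
    (x x' : M) {S : Set M} (hS : MeasurableSet S)
    (hSx' : S ⊆ (chartAt (EuclideanSpace ℝ (Fin n)) x').source)
    (hSx : f ⁻¹' S ⊆ (chartAt (EuclideanSpace ℝ (Fin n)) x).source) :
    chartVolume n M (chartAt (EuclideanSpace ℝ (Fin n)) x) (f ⁻¹' S) =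
      chartVolume n M (chartAt (EuclideanSpace ℝ (Fin n)) x') S := by
  set e := chartAt (EuclideanSpace ℝ (Fin n)) x with he
  set e' := chartAt (EuclideanSpace ℝ (Fin n)) x' with he'
  have hfS : MeasurableSet (f ⁻¹' S) := f.continuous.measurable hS
  rw [chartVolume_apply e hfS, chartVolume_apply e' hS]
  set W := e.target ∩ e.symm ⁻¹' (f ⁻¹' S) with hW
  set T : EuclideanSpace ℝ (Fin n) → EuclideanSpace ℝ (Fin n) := fun y => e' (f (e.symm y))
    with hT
  have hWm : MeasurableSet W := measurableSet_inter_preimage_of_continuousOn e.continuousOn_symm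
    e.open_target.measurableSet hfS
  have himage : T '' W = e'.target ∩ e'.symm ⁻¹' S := by
    ext w
    constructor
    · rintro ⟨y, ⟨-, hy⟩, rfl⟩
      refine ⟨e'.map_source (hSx' hy), ?_⟩
      rw [mem_preimage, e'.left_inv (hSx' hy)]
      exact hy
    · rintro ⟨hw, hwS⟩
      obtain ⟨z, hz⟩ := f.surjective (e'.symm w)
      have hzS : z ∈ f ⁻¹' S := by rw [mem_preimage, hz]; exact hwS
      refine ⟨e z, ⟨e.map_source (hSx hzS), ?_⟩, ?_⟩
      · rw [mem_preimage, e.left_inv (hSx hzS)]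
        exact hzS
      · simp only [hT]
        rw [e.left_inv (hSx hzS), hz, e'.right_inv hw]
  have hinj : InjOn T W := by
    rintro y ⟨hy, hyS⟩ z ⟨hz, hzS⟩ hyz
    have := e'.injOn (hSx' hyS) (hSx' hzS) hyz
    exact e.symm.injOn hy hz (f.injective this)
  have hmf : ∀ p, MDifferentiableAt (𝓡 n) (𝓡 n) f p := fun p =>
    (hf p).mdifferentiableAt (by simp)
  have hme : ∀ y ∈ e.target, MDifferentiableAt (𝓡 n) (𝓡 n) e.symm y := fun y hy =>
    (mdifferentiable_chart (I := 𝓡 n) x).mdifferentiableAt_symm hy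
  have hme' : ∀ y ∈ e'.target, MDifferentiableAt (𝓡 n) (𝓡 n) e'.symm y := fun y hy =>
    (mdifferentiable_chart (I := 𝓡 n) x').mdifferentiableAt_symm hy
  have hdiff : ∀ y ∈ W, DifferentiableAt ℝ T y := by
    rintro y ⟨hy, hyS⟩
    rw [← mdifferentiableAt_iff_differentiableAt]
    have h1 : MDifferentiableAt (𝓡 n) (𝓡 n) e' (f (e.symm y)) :=
      (mdifferentiable_chart (I := 𝓡 n) x').mdifferentiableAt (hSx' hyS)
    exact h1.comp y ((hmf _).comp y (hme y hy))
  rw [← himage, lintegral_image_eq_lintegral_abs_det_fderiv_mul volume hWm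
    (fun y hy => (hdiff y hy).hasFDerivAt.hasFDerivWithinAt) hinj]
  refine setLIntegral_congr_fun hWm fun y hy => ?_
  have hTy : T y ∈ e'.target := e'.map_source (hSx' hy.2)
  rw [← ENNReal.ofReal_mul (abs_nonneg _)]
  congr 1
  refine sqrt_det_gramMatrix_eq hisom (hdiff y hy) (hmf _) (hme y hy.1) (hme' _ hTy) ?_
  have hopen : IsOpen (e.target ∩ e.symm ⁻¹' (f ⁻¹' e'.source)) :=
    e.isOpen_inter_preimage_symm (e'.open_source.preimage f.continuous)
  filter_upwards [hopen.mem_nhds ⟨hy.1, hSx' hy.2⟩] with z hz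
  exact e'.left_inv hz.2

/-- On the domain of a chart, the Riemannian volume is the one computed in this chart. -/
theorem riemannianVolume_apply_of_subset_source [IsManifold (𝓡 n) ∞ M] (x : M) {S : Set M}
    (hS : MeasurableSet S) (hSx : S ⊆ (chartAt (EuclideanSpace ℝ (Fin n)) x).source) :
    riemannianVolume n M S = chartVolume n M (chartAt (EuclideanSpace ℝ (Fin n)) x) S := by
  set μ : M → Measure M := fun x => chartVolume n M (chartAt (EuclideanSpace ℝ (Fin n)) x) with hμ
  set U := (chartAt (EuclideanSpace ℝ (Fin n)) x).source with hU
  have hUm : MeasurableSet U := (chartAt (EuclideanSpace ℝ (Fin n)) x).open_source.measurableSet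
  refine le_antisymm ?_ (le_iSup μ x S)
  have hle : riemannianVolume n M ≤
      (μ x).restrict U + (riemannianVolume n M).restrict Uᶜ := by
    refine iSup_le fun y => Measure.le_iff.2 fun T hT => ?_
    rw [Measure.add_apply, Measure.restrict_apply hT, Measure.restrict_apply hT,
      ← measure_inter_add_sdiff T hUm]
    refine add_le_add ?_ (le_iSup μ y _)
    have hUy : MeasurableSet (chartAt (EuclideanSpace ℝ (Fin n)) y).source :=
      (chartAt (EuclideanSpace ℝ (Fin n)) y).open_source.measurableSet
    rw [← chartVolume_source_inter _ (hT.inter hUm)]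
    have hcc := chartVolume_preimage (Homeomorph.refl M) contMDiff_id
      (fun x v w => by
        have : mfderiv (𝓡 n) (𝓡 n) (Homeomorph.refl M) x = ContinuousLinearMap.id ℝ _ := mfderiv_id
        rw [this]; rfl) y x ((hT.inter hUm).inter hUy)
      (fun z hz => hz.1.2) (fun z hz => hz.2)
    exact hcc.trans_le (measure_mono inter_subset_left)
  refine (hle S).trans ?_
  rw [Measure.add_apply, Measure.restrict_apply hS, Measure.restrict_apply hS,
    inter_eq_left.2 hSx, ← sdiff_eq, sdiff_eq_empty.2 hSx, measure_empty, add_zero]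

theorem isLocallyFiniteMeasure_riemannianVolume [IsManifold (𝓡 n) ∞ M]
    [IsContMDiffRiemannianBundle (𝓡 n) ∞ (EuclideanSpace ℝ (Fin n))
      (fun x : M => TangentSpace (𝓡 n) x)] :
    IsLocallyFiniteMeasure (riemannianVolume n M) := by
  refine ⟨fun x => ?_⟩
  set e := chartAt (EuclideanSpace ℝ (Fin n)) x with he
  have hxe : x ∈ e.source := mem_chart_source _ _
  have hx : e x ∈ e.target := e.map_source hxe
  set ρ : EuclideanSpace ℝ (Fin n) → ℝ := fun y => Real.sqrt (gramMatrix n M e y).det with hρ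
  have hcont : ContinuousAt ρ (e x) :=
    (Real.continuous_sqrt.comp_continuousOn (continuousOn_gramMatrix_det x)).continuousAt
      (e.open_target.mem_nhds hx)
  obtain ⟨r, hr, hball⟩ := Metric.mem_nhds_iff.1 (Filter.inter_mem (e.open_target.mem_nhds hx)
    (hcont (Iio_mem_nhds (show ρ (e x) < ρ (e x) + 1 by linarith))))
  set S := e.source ∩ e ⁻¹' Metric.ball (e x) r with hS
  have hSo : IsOpen S := e.isOpen_inter_preimage Metric.isOpen_ball
  refine ⟨S, hSo.mem_nhds ⟨hxe, Metric.mem_ball_self hr⟩, ?_⟩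
  rw [riemannianVolume_apply_of_subset_source x hSo.measurableSet inter_subset_left,
    chartVolume_apply _ hSo.measurableSet]
  have hsub : e.target ∩ e.symm ⁻¹' S ⊆ Metric.ball (e x) r := by
    rintro y ⟨hy, hyS⟩
    simpa [e.right_inv hy] using hyS.2
  refine (lintegral_mono_set hsub).trans_lt ?_
  refine (setLIntegral_mono measurable_const (g := fun _ => ENNReal.ofReal (ρ (e x) + 1))
    fun y hy => ENNReal.ofReal_le_ofReal (le_of_lt (hball hy).2)).trans_lt ?_
  rw [setLIntegral_const]
  exact ENNReal.mul_lt_top ENNReal.ofReal_lt_top measure_ball_lt_top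

variable [SecondCountableTopology M]

/-- A diffeomorphism which is infinitesimally isometric preserves the Riemannian volume. -/
theorem measurePreserving_riemannianVolume [IsManifold (𝓡 n) ∞ M] (f : M ≃ₜ M)
    (hf : ContMDiff (𝓡 n) (𝓡 n) ∞ f)
    (hisom : ∀ (x : M) (v w : TangentSpace (𝓡 n) x),
      inner ℝ (mfderiv (𝓡 n) (𝓡 n) f x v) (mfderiv (𝓡 n) (𝓡 n) f x w) = inner ℝ v w) :
    MeasurePreserving f (riemannianVolume n M) (riemannianVolume n M) := by
  have hfm : Measurable f := f.continuous.measurable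
  refine ⟨hfm, ?_⟩
  let V : M × M → Set M := fun p => (chartAt (EuclideanSpace ℝ (Fin n)) p.2).source ∩
    f.symm ⁻¹' (chartAt (EuclideanSpace ℝ (Fin n)) p.1).source
  have hV : ∀ p, IsOpen (V p) := fun p => (chartAt _ p.2).open_source.inter
    ((chartAt _ p.1).open_source.preimage f.symm.continuous)
  obtain ⟨D, hD, hcover⟩ := TopologicalSpace.isOpen_iUnion_countable V hV
  have huniv : ⋃ p ∈ D, V p = univ := by
    rw [hcover]
    exact eq_univ_of_forall fun x => mem_iUnion.2
      ⟨(f.symm x, x), mem_chart_source _ _, mem_chart_source _ (f.symm x)⟩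
  rw [Measure.ext_iff_of_biUnion_eq_univ hD huniv]
  intro p _
  refine Measure.ext fun S hS => ?_
  have hSV := hS.inter (hV p).measurableSet
  rw [Measure.restrict_apply hS, Measure.restrict_apply hS, Measure.map_apply hfm hSV,
    riemannianVolume_apply_of_subset_source p.2 hSV fun z hz => hz.2.1,
    riemannianVolume_apply_of_subset_source p.1 (hfm hSV) fun z hz => by
      simpa using hz.2.2]
  exact chartVolume_preimage f hf hisom _ _ hSV (fun z hz => hz.2.1) fun z hz => by
      simpa using hz.2.2

end RiemannianVolume

/-! ### The Hilbert space of square integrable sections -/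

section Fiber

variable {M : Type*} [TopologicalSpace M] (F : Type*) [NormedAddCommGroup F] [NormedSpace ℝ F]
  {E : M → Type*} [TopologicalSpace (TotalSpace F E)] [∀ x, NormedAddCommGroup (E x)]
  [∀ x, InnerProductSpace ℝ (E x)] [FiberBundle F E] [VectorBundle ℝ F E]

theorem finiteDimensional_fiber [FiniteDimensional ℝ F] (x : M) : FiniteDimensional ℝ (E x) :=
  ((trivializationAt F E x).continuousLinearEquivAt ℝ x
    (FiberBundle.mem_baseSet_trivializationAt' x)).toLinearEquiv.symm.finiteDimensional

theorem finrank_fiber (x : M) : Module.finrank ℝ (E x) = Module.finrank ℝ F :=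
  ((trivializationAt F E x).continuousLinearEquivAt ℝ x
    (FiberBundle.mem_baseSet_trivializationAt' x)).toLinearEquiv.finrank_eq

theorem MemL2.restrict {M : Type*} [TopologicalSpace M] [MeasurableSpace M] {F : Type*}
    [NormedAddCommGroup F] {E : M → Type*} [TopologicalSpace (TotalSpace F E)]
    [∀ x, NormedAddCommGroup (E x)] [FiberBundle F E] {μ : Measure M} {s : ∀ x, E x}
    (hs : MemL2 F E μ s) (S : Set M) :
    MemL2 F E (μ.restrict S) s :=
  ⟨fun x₀ => (hs.1 x₀).mono_measure (Measure.restrict_mono_measure Measure.restrict_le_self _),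
    (lintegral_mono' Measure.restrict_le_self le_rfl).trans_lt hs.2⟩

end Fiber

section L2Space

variable {M : Type*} [TopologicalSpace M] [MeasurableSpace M]
  {F : Type*} [NormedAddCommGroup F] [NormedSpace ℝ F]
  {E : M → Type*} [TopologicalSpace (TotalSpace F E)] [∀ x, NormedAddCommGroup (E x)]
  [∀ x, InnerProductSpace ℝ (E x)] [FiberBundle F E] [VectorBundle ℝ F E]
  [FiniteDimensional ℝ F] [IsContinuousRiemannianBundle F E]
  [SecondCountableTopology M] [OpensMeasurableSpace M] {μ : Measure M}

theorem MemL2.sub {s t : ∀ x, E x} (hs : MemL2 F E μ s) (ht : MemL2 F E μ t) :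
    MemL2 F E μ (s - t) :=
  (sqIntegrableSections F E μ).sub_mem hs ht

theorem MemL2.memLp_norm {s : ∀ x, E x} (hs : MemL2 F E μ s) :
    MemLp (fun x => ‖s x‖) 2 μ := by
  have hm : AEStronglyMeasurable (fun x => ‖s x‖) μ := by
    refine (Real.continuous_sqrt.comp_aestronglyMeasurable (hs.1.inner hs.1)).congr
      (Filter.Eventually.of_forall fun x => ?_)
    exact (norm_eq_sqrt_real_inner (s x)).symm
  refine ⟨hm, ?_⟩
  rw [eLpNorm_lt_top_iff_lintegral_rpow_enorm_lt_top (by norm_num) (by norm_num)]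
  simpa using hs.2

theorem L2.memL2_rep (u : L2 F E μ) : MemL2 F E μ u.rep :=
  PreL2.memL2 (Quotient.out u)

theorem L2.ofSection_of_memL2 {s : ∀ x, E x} (hs : MemL2 F E μ s) :
    L2.ofSection F μ s =
      SeparationQuotient.mk (show PreL2 F E μ from (⟨s, hs⟩ : sqIntegrableSections F E μ)) :=
  dif_pos hs

theorem L2.ofSection_rep (u : L2 F E μ) : L2.ofSection F μ u.rep = u := by
  rw [L2.ofSection_of_memL2 u.memL2_rep]
  exact Quotient.out_eq u

theorem L2.inner_ofSection {s t : ∀ x, E x} (hs : MemL2 F E μ s) (ht : MemL2 F E μ t) :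
    inner ℝ (L2.ofSection F μ s) (L2.ofSection F μ t) = ∫ x, inner ℝ (s x) (t x) ∂μ := by
  rw [L2.ofSection_of_memL2 hs, L2.ofSection_of_memL2 ht]
  rfl

theorem L2.inner_eq_integral (u v : L2 F E μ) :
    inner ℝ u v = ∫ x, inner ℝ (u.rep x) (v.rep x) ∂μ := by
  rw [← L2.inner_ofSection u.memL2_rep v.memL2_rep, L2.ofSection_rep, L2.ofSection_rep]

theorem L2.norm_sq_ofSection {s : ∀ x, E x} (hs : MemL2 F E μ s) :
    ‖L2.ofSection F μ s‖ ^ 2 = ∫ x, ‖s x‖ ^ 2 ∂μ := by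
  rw [← real_inner_self_eq_norm_sq, L2.inner_ofSection hs hs]
  simp only [real_inner_self_eq_norm_sq]

theorem L2.norm_sq_eq_integral (u : L2 F E μ) : ‖u‖ ^ 2 = ∫ x, ‖u.rep x‖ ^ 2 ∂μ := by
  rw [← L2.norm_sq_ofSection u.memL2_rep, L2.ofSection_rep]

theorem MemL2.integrable_norm_sq {s : ∀ x, E x} (hs : MemL2 F E μ s) :
    Integrable (fun x => ‖s x‖ ^ 2) μ := by
  simpa only [real_inner_self_eq_norm_sq] using hs.integrable_inner hs

theorem L2.lintegral_eq_ofReal_norm_sq {s : ∀ x, E x} (hs : MemL2 F E μ s) :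
    ∫⁻ x, ‖s x‖ₑ ^ 2 ∂μ = ENNReal.ofReal (‖L2.ofSection F μ s‖ ^ 2) := by
  rw [L2.norm_sq_ofSection hs, ofReal_integral_eq_lintegral_ofReal hs.integrable_norm_sq
    (Filter.Eventually.of_forall fun x => sq_nonneg _)]
  refine lintegral_congr fun x => ?_
  rw [ENNReal.ofReal_pow (norm_nonneg _), ofReal_norm]

theorem L2.ofSection_add {s t : ∀ x, E x} (hs : MemL2 F E μ s) (ht : MemL2 F E μ t) :
    L2.ofSection F μ (s + t) = L2.ofSection F μ s + L2.ofSection F μ t := by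
  rw [L2.ofSection_of_memL2 hs, L2.ofSection_of_memL2 ht, L2.ofSection_of_memL2 (hs.add ht)]
  rfl

theorem L2.ofSection_smul {s : ∀ x, E x} (c : ℝ) (hs : MemL2 F E μ s) :
    L2.ofSection F μ (c • s) = c • L2.ofSection F μ s := by
  rw [L2.ofSection_of_memL2 hs, L2.ofSection_of_memL2 (hs.smul c)]
  rfl

theorem L2.ofSection_sub {s t : ∀ x, E x} (hs : MemL2 F E μ s) (ht : MemL2 F E μ t) :
    L2.ofSection F μ (s - t) = L2.ofSection F μ s - L2.ofSection F μ t := by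
  rw [L2.ofSection_of_memL2 hs, L2.ofSection_of_memL2 ht, L2.ofSection_of_memL2 (hs.sub ht)]
  rfl

theorem L2.ofSection_eq_zero_iff {s : ∀ x, E x} (hs : MemL2 F E μ s) :
    L2.ofSection F μ s = 0 ↔ ∀ᵐ x ∂μ, s x = 0 := by
  rw [← norm_eq_zero, ← sq_eq_zero_iff, L2.norm_sq_ofSection hs,
    integral_eq_zero_iff_of_nonneg (fun x => sq_nonneg _) hs.integrable_norm_sq]
  refine Filter.eventually_congr (Filter.Eventually.of_forall fun x => ?_)
  simp

theorem L2.ofSection_eq_ofSection_iff {s t : ∀ x, E x} (hs : MemL2 F E μ s)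
    (ht : MemL2 F E μ t) :
    L2.ofSection F μ s = L2.ofSection F μ t ↔ ∀ᵐ x ∂μ, s x = t x := by
  rw [← sub_eq_zero, ← L2.ofSection_sub hs ht, L2.ofSection_eq_zero_iff (hs.sub ht)]
  simp only [Pi.sub_apply, sub_eq_zero]

theorem L2.rep_ofSection {s : ∀ x, E x} (hs : MemL2 F E μ s) :
    ∀ᵐ x ∂μ, (L2.ofSection F μ s).rep x = s x := by
  rw [← L2.ofSection_eq_ofSection_iff (L2.memL2_rep _) hs, L2.ofSection_rep]

theorem L2.rep_add (u v : L2 F E μ) : ∀ᵐ x ∂μ, (u + v).rep x = u.rep x + v.rep x := by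
  have := L2.rep_ofSection (u.memL2_rep.add v.memL2_rep)
  rwa [L2.ofSection_add u.memL2_rep v.memL2_rep, L2.ofSection_rep, L2.ofSection_rep] at this

theorem L2.rep_zero : ∀ᵐ x ∂μ, (0 : L2 F E μ).rep x = 0 := by
  rw [← L2.ofSection_eq_zero_iff (L2.memL2_rep _), L2.ofSection_rep]

theorem L2.rep_smul (c : ℝ) (u : L2 F E μ) : ∀ᵐ x ∂μ, (c • u).rep x = c • u.rep x := by
  have := L2.rep_ofSection (u.memL2_rep.smul c)
  rwa [L2.ofSection_smul c u.memL2_rep, L2.ofSection_rep] at this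

theorem L2.rep_sum {κ : Type*} (s : Finset κ) (u : κ → L2 F E μ) :
    ∀ᵐ x ∂μ, (∑ i ∈ s, u i).rep x = ∑ i ∈ s, (u i).rep x := by
  classical
  induction s using Finset.induction_on with
  | empty => simpa using L2.rep_zero
  | insert i s hi ih =>
    filter_upwards [ih, L2.rep_add (u i) (∑ j ∈ s, u j)] with x h1 h2
    rw [Finset.sum_insert hi, Finset.sum_insert hi, h2, h1]

open Filter Topology in
/-- An `L²`-Cauchy sequence which converges almost everywhere converges in `L²`, by Fatou's
lemma. -/
theorem L2.tendsto_of_cauchySeq_of_ae_tendsto {V : ℕ → L2 F E μ} (hV : CauchySeq V)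
    {s : ∀ x, E x} (hs : ∀ᵐ x ∂μ, Tendsto (fun n => (V n).rep x) atTop (𝓝 (s x))) :
    Tendsto V atTop (𝓝 (L2.ofSection F μ s)) := by
  have hmeas : MeasurableSection F E μ s := by
    intro x₀
    refine aestronglyMeasurable_of_tendsto_ae atTop (fun n => (V n).memL2_rep.1 x₀) ?_
    filter_upwards [ae_restrict_of_ae hs,
      ae_restrict_mem (trivializationAt F E x₀).open_baseSet.measurableSet] with x hx hxb
    have h1 := (((trivializationAt F E x₀).continuousLinearMapAt ℝ x).continuous.tendsto
      (s x)).comp hx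
    simpa only [Function.comp_def, Trivialization.continuousLinearMapAt_apply,
      Trivialization.coe_linearMapAt_of_mem _ hxb] using h1
  have hfatou : ∀ (N : ℕ) (ε : ℝ), 0 ≤ ε → (∀ m ≥ N, ‖V m - V N‖ ≤ ε) →
      ∫⁻ x, ‖(s - (V N).rep) x‖ₑ ^ 2 ∂μ ≤ ENNReal.ofReal (ε ^ 2) := by
    intro N ε hε hN
    have hm : ∀ m, MemL2 F E μ ((V m).rep - (V N).rep) := fun m =>
      (V m).memL2_rep.sub (V N).memL2_rep
    calc ∫⁻ x, ‖(s - (V N).rep) x‖ₑ ^ 2 ∂μ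
        = ∫⁻ x, liminf (fun m => ‖((V m).rep - (V N).rep) x‖ₑ ^ 2) atTop ∂μ := by
          refine lintegral_congr_ae ?_
          filter_upwards [hs] with x hx
          have h1 : Tendsto (fun m => ‖((V m).rep - (V N).rep) x‖ₑ ^ 2) atTop
              (𝓝 (‖(s - (V N).rep) x‖ₑ ^ 2)) := by
            have := (continuous_enorm.tendsto _).comp (hx.sub_const ((V N).rep x))
            exact (ENNReal.continuous_pow 2).tendsto _ |>.comp this
          exact h1.liminf_eq.symm
      _ ≤ liminf (fun m => ∫⁻ x, ‖((V m).rep - (V N).rep) x‖ₑ ^ 2 ∂μ) atTop := by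
          refine lintegral_liminf_le' fun m => ?_
          have := (hm m).memLp_norm.1.enorm.pow_const 2
          simpa only [enorm_norm] using this
      _ ≤ ENNReal.ofReal (ε ^ 2) := by
          refine liminf_le_of_frequently_le' (Eventually.frequently ?_)
          filter_upwards [eventually_ge_atTop N] with m hmN
          rw [L2.lintegral_eq_ofReal_norm_sq (hm m),
            L2.ofSection_sub (V m).memL2_rep (V N).memL2_rep, L2.ofSection_rep, L2.ofSection_rep]
          exact ENNReal.ofReal_le_ofReal (pow_le_pow_left₀ (norm_nonneg _) (hN m hmN) 2)
  have hsub : ∀ N, MeasurableSection F E μ (s - (V N).rep) := fun N => by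
    have := hmeas.add (((V N).memL2_rep.smul (-1)).1)
    rwa [neg_one_smul, ← sub_eq_add_neg] at this
  have hcau := Metric.cauchySeq_iff'.1 hV
  have hmem : MemL2 F E μ s := by
    obtain ⟨N, hN⟩ := hcau 1 one_pos
    have h1 : MemL2 F E μ (s - (V N).rep) := ⟨hsub N, (hfatou N 1 zero_le_one fun m hm => by
      rw [← dist_eq_norm]; exact (hN m hm).le).trans_lt ENNReal.ofReal_lt_top⟩
    simpa using h1.add (V N).memL2_rep
  rw [Metric.tendsto_atTop]
  intro ε hε
  obtain ⟨N, hN⟩ := Metric.cauchySeq_iff.1 hV (ε / 2) (half_pos hε)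
  refine ⟨N, fun k hk => ?_⟩
  have h2 := hfatou k (ε / 2) (half_pos hε).le fun m hm => by
    rw [← dist_eq_norm]; exact (hN m (hk.le.trans hm) k hk).le
  rw [L2.lintegral_eq_ofReal_norm_sq (hmem.sub (V k).memL2_rep),
    L2.ofSection_sub hmem (V k).memL2_rep, L2.ofSection_rep,
    ENNReal.ofReal_le_ofReal_iff (by positivity)] at h2
  rw [dist_comm, dist_eq_norm]
  exact (abs_le_of_sq_le_sq' h2 (half_pos hε).le).2.trans_lt (half_lt_self hε)

/-- For `‖u n‖` summable, the series `∑ u n` converges absolutely at almost every point: on a set of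
finite measure the `L¹`-norms are controlled by the `L²`-norms. -/
theorem L2.ae_summable_norm_rep [SigmaFinite μ] {u : ℕ → L2 F E μ}
    (hu : Summable fun n => ‖u n‖) : ∀ᵐ x ∂μ, Summable fun n => ‖(u n).rep x‖ := by
  suffices h : ∀ᵐ x ∂μ.restrict (⋃ k, spanningSets μ k), Summable fun n => ‖(u n).rep x‖ by
    rwa [iUnion_spanningSets μ, Measure.restrict_univ] at h
  rw [ae_restrict_iUnion_iff]
  intro k
  set ν := μ.restrict (spanningSets μ k) with hν
  have hνfin : ν univ < ⊤ := by
    rw [hν, Measure.restrict_apply_univ]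
    exact measure_spanningSets_lt_top μ k
  have hnorm : ∀ n, eLpNorm (fun x => ‖(u n).rep x‖) 2 μ = ENNReal.ofReal ‖u n‖ := by
    intro n
    have h2 := L2.lintegral_eq_ofReal_norm_sq (u n).memL2_rep
    rw [L2.ofSection_rep] at h2
    rw [eLpNorm_eq_lintegral_rpow_enorm_toReal (by norm_num) (by norm_num)]
    simp only [ENNReal.toReal_ofNat, enorm_norm, ENNReal.rpow_ofNat]
    rw [h2, ENNReal.ofReal_rpow_of_nonneg (by positivity) (by norm_num),
      ← Real.sqrt_eq_rpow, Real.sqrt_sq (norm_nonneg _)]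
  have hle : ∀ n, ∫⁻ x, ‖(u n).rep x‖ₑ ∂ν ≤
      ENNReal.ofReal ‖u n‖ * ν univ ^ (1 / (1 : ENNReal).toReal - 1 / (2 : ENNReal).toReal) := by
    intro n
    have h1 := eLpNorm_le_eLpNorm_mul_rpow_measure_univ (μ := ν) (p := 1) (q := 2) (by norm_num)
      (u n).memL2_rep.memLp_norm.1.restrict
    rw [eLpNorm_one_eq_lintegral_enorm] at h1
    simp only [enorm_norm] at h1
    refine h1.trans (mul_le_mul_left ?_ _)
    exact (eLpNorm_mono_measure _ Measure.restrict_le_self).trans_eq (hnorm n)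
  have hfin : ∫⁻ x, ∑' n, ‖(u n).rep x‖ₑ ∂ν < ⊤ := by
    rw [lintegral_tsum fun n => by
      simpa only [enorm_norm] using (u n).memL2_rep.memLp_norm.1.restrict.enorm]
    refine (ENNReal.tsum_le_tsum hle).trans_lt ?_
    rw [ENNReal.tsum_mul_right, ← ENNReal.ofReal_tsum_of_nonneg (fun n => norm_nonneg _) hu]
    refine ENNReal.mul_lt_top ENNReal.ofReal_lt_top ?_
    exact ENNReal.rpow_lt_top_of_nonneg (by norm_num) hνfin.ne
  have hm : AEMeasurable (fun x => ∑' n, ‖(u n).rep x‖ₑ) ν := AEMeasurable.tsum fun n => by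
    simpa only [enorm_norm] using (u n).memL2_rep.memLp_norm.1.restrict.enorm
  filter_upwards [ae_lt_top' hm hfin.ne] with x hx
  have := ENNReal.summable_toReal hx.ne
  simpa using this

/-- The Riesz-Fischer theorem for sections of a vector bundle. -/
instance [SigmaFinite μ] : CompleteSpace (L2 F E μ) := by
  refine NormedAddCommGroup.completeSpace_of_summable_imp_tendsto fun u hu => ?_
  refine ⟨_, L2.tendsto_of_cauchySeq_of_ae_tendsto (s := fun x => ∑' n, (u n).rep x)
    (cauchySeq_range_of_norm_bounded hu.hasSum.tendsto_sum_nat.cauchySeq fun _ => le_rfl) ?_⟩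
  filter_upwards [L2.ae_summable_norm_rep hu, ae_all_iff.2 fun n =>
    L2.rep_sum (Finset.range n) u] with x hx hsum
  have : FiniteDimensional ℝ (E x) := finiteDimensional_fiber F x
  have : CompleteSpace (E x) := FiniteDimensional.complete ℝ (E x)
  simp only [hsum]
  exact hx.of_norm.hasSum.tendsto_sum_nat

end L2Space

/-! ### Translates of sections, and the orthonormal basis of translates -/

section Translate

variable {G : Type*} [Group G] {M : Type*} [MulAction G M]
theorem mem_image_smul_iff {K : Set M} {g : G} {x : M} :
    x ∈ (fun y => g • y) '' K ↔ g⁻¹ • x ∈ K := by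
  constructor
  · rintro ⟨y, hy, rfl⟩
    simpa using hy
  · exact fun h => ⟨_, h, by simp⟩

variable {n : ℕ} [TopologicalSpace M] [ChartedSpace (EuclideanSpace ℝ (Fin n)) M]
  {F : Type*} [NormedAddCommGroup F] [NormedSpace ℝ F]
  {E : M → Type*} [TopologicalSpace (TotalSpace F E)] [∀ x, NormedAddCommGroup (E x)]
  [∀ x, InnerProductSpace ℝ (E x)] [FiberBundle F E]
  (ρ : EquivariantStructure G n F E)

theorem EquivariantStructure.mk_act_mul_of_eq_one {g h : G} (hgh : g * h = 1) (x : M) (v : E x) :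
    (⟨g • h • x, ρ.act g (h • x) (ρ.act h x v)⟩ : TotalSpace F E) = ⟨x, v⟩ := by
  rw [← ρ.act_mul, hgh, ρ.act_one]

theorem EquivariantStructure.translate_of_mem {K : Set M} {g : G} {x : M} (hx : g⁻¹ • x ∈ K)
    (s : ∀ x, E x) : ρ.translate K g s x = (ρ.act g⁻¹ x).symm (s (g⁻¹ • x)) :=
  if_pos (mem_image_smul_iff.2 hx)

theorem EquivariantStructure.translate_of_notMem {K : Set M} {g : G} {x : M} (hx : g⁻¹ • x ∉ K)
    (s : ∀ x, E x) : ρ.translate K g s x = 0 :=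
  if_neg fun h => hx (mem_image_smul_iff.1 h)

/-- The translate of a section over `gK` is its image under the action of `g` on the total space. -/
theorem EquivariantStructure.mk_translate {K : Set M} {g : G} {x : M} (hx : g⁻¹ • x ∈ K)
    (s : ∀ x, E x) : (⟨x, ρ.translate K g s x⟩ : TotalSpace F E) =
      ⟨g • g⁻¹ • x, ρ.act g (g⁻¹ • x) (s (g⁻¹ • x))⟩ := by
  rw [ρ.translate_of_mem hx]
  have := ρ.mk_act_mul_of_eq_one (mul_inv_cancel g) x ((ρ.act g⁻¹ x).symm (s (g⁻¹ • x)))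
  rw [LinearIsometryEquiv.apply_symm_apply] at this
  exact this.symm

theorem EquivariantStructure.inner_translate {K : Set M} (g : G) (s t : ∀ x, E x) (x : M) :
    (inner ℝ (ρ.translate K g s x) (ρ.translate K g t x) : ℝ) =
      K.indicator (fun y => inner ℝ (s y) (t y)) (g⁻¹ • x) := by
  by_cases hx : g⁻¹ • x ∈ K
  · rw [ρ.translate_of_mem hx, ρ.translate_of_mem hx, LinearIsometryEquiv.inner_map_map,
      indicator_of_mem hx]
  · rw [ρ.translate_of_notMem hx, inner_zero_left, indicator_of_notMem hx]

theorem EquivariantStructure.norm_translate {K : Set M} (g : G) (s : ∀ x, E x) (x : M) :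
    ‖ρ.translate K g s x‖ = K.indicator (fun y => ‖s y‖) (g⁻¹ • x) := by
  by_cases hx : g⁻¹ • x ∈ K
  · rw [ρ.translate_of_mem hx, LinearIsometryEquiv.norm_map, indicator_of_mem hx]
  · rw [ρ.translate_of_notMem hx, norm_zero, indicator_of_notMem hx]

/-- Pulling a section back by `g` and pushing it forward to `gK` again restricts it to `gK`. -/
theorem EquivariantStructure.translate_translate_inv {K : Set M} {g : G} {x : M}
    (hx : g⁻¹ • x ∈ K) (s : ∀ x, E x) :
    ρ.translate K g (ρ.translate univ g⁻¹ s) x = s x := by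
  have h1 := ρ.mk_translate hx (ρ.translate univ g⁻¹ s)
  have h2 : (⟨g⁻¹ • x, ρ.translate univ g⁻¹ s (g⁻¹ • x)⟩ : TotalSpace F E) =
      ⟨g⁻¹ • x, ρ.act g⁻¹ x (s x)⟩ := by
    rw [ρ.mk_translate (mem_univ _)]
    have : g⁻¹⁻¹ • g⁻¹ • x = x := by simp
    rw [this]
  have h3 : ρ.translate univ g⁻¹ s (g⁻¹ • x) = ρ.act g⁻¹ x (s x) := by simpa using h2
  rw [h3, ρ.mk_act_mul_of_eq_one (mul_inv_cancel g)] at h1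
  simpa using h1

/-- Against sections supported in `gK`, the restriction of `t` to `gK` is as good as `t`. -/
theorem EquivariantStructure.inner_translate_translate_inv {K : Set M} (g : G) (s t : ∀ x, E x)
    (x : M) : (inner ℝ (ρ.translate K g s x) (ρ.translate K g (ρ.translate univ g⁻¹ t) x) : ℝ) =
      inner ℝ (ρ.translate K g s x) (t x) := by
  by_cases hx : g⁻¹ • x ∈ K
  · rw [ρ.translate_translate_inv hx]
  · rw [ρ.translate_of_notMem hx, inner_zero_left, inner_zero_left]

variable [MeasurableSpace M] [BorelSpace M] [ContinuousConstSMul G M] {μ : Measure M}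
  [SMulInvariantMeasure G M μ] {K : Set M}

theorem EquivariantStructure.integral_inner_translate (hK : MeasurableSet K) (g : G)
    (s t : ∀ x, E x) :
    ∫ x, (inner ℝ (ρ.translate K g s x) (ρ.translate K g t x) : ℝ) ∂μ =
      ∫ y, inner ℝ (s y) (t y) ∂(μ.restrict K) := by
  simp only [ρ.inner_translate]
  rw [(measurePreserving_smul g⁻¹ μ).integral_comp
    (Homeomorph.smul g⁻¹).measurableEmbedding, integral_indicator hK]

variable [SecondCountableTopology M] [VectorBundle ℝ F E] [FiniteDimensional ℝ F]

/-- In local trivializations the translate is a continuous function of the point and the coordinates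
of the given section, so that measurability is inherited. -/
theorem MeasurableSection.translate (hK : MeasurableSet K) (g : G) {s : ∀ x, E x}
    (hs : MeasurableSection F E (μ.restrict K) s) :
    MeasurableSection F E μ (ρ.translate K g s) := by
  classical
  borelize F
  intro x₀
  set e₀ := trivializationAt F E x₀ with he₀
  set Φ : TotalSpace F E → TotalSpace F E := fun p => ⟨g • p.1, ρ.act g p.1 p.2⟩ with hΦ
  have hΦc : Continuous Φ := (ρ.contMDiff_act g).continuous
  obtain ⟨D, hD, hcover⟩ := TopologicalSpace.isOpen_iUnion_countable
    (fun x₁ : M => (trivializationAt F E x₁).baseSet)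
    (fun x₁ => (trivializationAt F E x₁).open_baseSet)
  have huniv : ⋃ x₁ ∈ D, (trivializationAt F E x₁).baseSet = univ := by
    rw [hcover]
    exact eq_univ_of_forall fun x => mem_iUnion.2 ⟨x, FiberBundle.mem_baseSet_trivializationAt' x⟩
  have : Countable D := hD.to_subtype
  have hgm : Measurable fun x : M => g⁻¹ • x := measurable_const_smul g⁻¹
  set gK := (fun x : M => g⁻¹ • x) ⁻¹' K with hgK
  have hgKm : MeasurableSet gK := hgm hK
  have hloc : AEStronglyMeasurable (fun x => (e₀ ⟨x, ρ.translate K g s x⟩).2)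
      ((μ.restrict e₀.baseSet).restrict gK) := by
    have hU : ⋃ x₁ : D, (fun x : M => g⁻¹ • x) ⁻¹' (trivializationAt F E (x₁ : M)).baseSet
        = univ := by
      rw [← preimage_iUnion, ← biUnion_eq_iUnion D fun x _ => (trivializationAt F E x).baseSet,
        huniv, preimage_univ]
    rw [← Measure.restrict_univ (μ := (μ.restrict e₀.baseSet).restrict gK), ← hU,
      aestronglyMeasurable_iUnion_iff]
    rintro ⟨x₁, -⟩
    set e₁ := trivializationAt F E x₁ with he₁
    set V := (fun x : M => g⁻¹ • x) ⁻¹' e₁.baseSet with hV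
    have hVo : IsOpen V := e₁.open_baseSet.preimage (continuous_const_smul g⁻¹)
    set ν := ((μ.restrict e₀.baseSet).restrict gK).restrict V with hν
    -- the coordinate expression of `s` near `g⁻¹ x`, as a function of `x`
    have ha : AEMeasurable (fun x => (e₁ ⟨g⁻¹ • x, s (g⁻¹ • x)⟩).2) ν := by
      have h1 : AEMeasurable (fun y => (e₁ ⟨y, s y⟩).2)
          ((μ.restrict K).restrict e₁.baseSet) := (hs x₁).aemeasurable
      have h2 : MeasurePreserving (fun x : M => g⁻¹ • x) ((μ.restrict gK).restrict V)
          ((μ.restrict K).restrict e₁.baseSet) :=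
        ((measurePreserving_smul g⁻¹ μ).restrict_preimage hK).restrict_preimage
          e₁.open_baseSet.measurableSet
      have h3 := h1.comp_quasiMeasurePreserving h2.quasiMeasurePreserving
      refine h3.mono_measure ?_
      exact Measure.restrict_mono_measure
        (Measure.restrict_mono_measure Measure.restrict_le_self _) _
    set O : Set (M × F) := (e₀.baseSet ∩ V) ×ˢ univ with hO
    have hOo : IsOpen O := (e₀.open_baseSet.inter hVo).prod isOpen_univ
    set Ψ : M × F → F := fun p => (e₀ (Φ ⟨g⁻¹ • p.1, e₁.symm (g⁻¹ • p.1) p.2⟩)).2 with hΨ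
    have hΨc : ContinuousOn Ψ O := by
      have h1 : ContinuousOn (fun p : M × F => (⟨g⁻¹ • p.1, e₁.symm (g⁻¹ • p.1) p.2⟩ :
          TotalSpace F E)) O := by
        refine (e₁.continuousOn_invFun.comp (f := fun p : M × F => (g⁻¹ • p.1, p.2)) (s := O)
          (by fun_prop) (fun p hp => ?_)).congr fun p hp => ?_
        · have : g⁻¹ • p.1 ∈ e₁.baseSet := hp.1.2
          simpa [e₁.mem_target] using this
        · exact e₁.mk_symm hp.1.2 p.2
      have h2 : ContinuousOn (fun p : M × F => e₀ (Φ ⟨g⁻¹ • p.1, e₁.symm (g⁻¹ • p.1) p.2⟩)) O := by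
        refine e₀.continuousOn.comp (hΦc.comp_continuousOn h1) fun p hp => ?_
        rw [e₀.mem_source]
        simpa [hΦ] using hp.1.1
      exact continuous_snd.comp_continuousOn h2
    have hΨm : Measurable (O.piecewise Ψ fun _ => 0) :=
      hΨc.measurable_piecewise continuousOn_const hOo.measurableSet
    have hcomp := (hΨm.comp_aemeasurable (aemeasurable_id.prodMk ha)).aestronglyMeasurable
    refine hcomp.congr ?_
    have hae1 : ∀ᵐ x ∂ν, x ∈ V := ae_restrict_mem hVo.measurableSet
    have hae2 : ∀ᵐ x ∂ν, x ∈ gK := ae_restrict_of_ae (ae_restrict_mem hgKm)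
    have hae3 : ∀ᵐ x ∂ν, x ∈ e₀.baseSet :=
      ae_restrict_of_ae (ae_restrict_of_ae (ae_restrict_mem e₀.open_baseSet.measurableSet))
    filter_upwards [hae1, hae2, hae3] with x hxV hxK hx0
    have hmem : (x, (e₁ ⟨g⁻¹ • x, s (g⁻¹ • x)⟩).2) ∈ O := ⟨⟨hx0, hxV⟩, mem_univ _⟩
    simp only [Function.comp_apply, id_eq]
    rw [piecewise_eq_of_mem _ _ _ hmem]
    simp only [hΨ]
    rw [e₁.symm_apply_apply_mk hxV, ρ.mk_translate hxK]
  rw [← aestronglyMeasurable_indicator_iff hgKm] at hloc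
  refine hloc.congr ?_
  filter_upwards [ae_restrict_mem e₀.open_baseSet.measurableSet] with x hx
  by_cases hxK : x ∈ gK
  · rw [indicator_of_mem hxK]
  · rw [indicator_of_notMem hxK, ρ.translate_of_notMem hxK]
    exact (((trivializationAt F E x₀).linear ℝ hx).map_zero).symm

theorem MemL2.translate (hK : MeasurableSet K) (g : G) {s : ∀ x, E x}
    (hs : MemL2 F E (μ.restrict K) s) : MemL2 F E μ (ρ.translate K g s) := by
  refine ⟨hs.1.translate ρ hK g, ?_⟩
  have h1 : ∀ x, ‖ρ.translate K g s x‖ₑ ^ 2 = K.indicator (fun y => ‖s y‖ₑ ^ 2) (g⁻¹ • x) := by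
    intro x
    rw [← enorm_norm, ρ.norm_translate]
    by_cases hx : g⁻¹ • x ∈ K
    · rw [indicator_of_mem hx, indicator_of_mem hx, enorm_norm]
    · rw [indicator_of_notMem hx, indicator_of_notMem hx]; simp
  simp only [h1]
  rw [(measurePreserving_smul g⁻¹ μ).lintegral_comp_emb
    (Homeomorph.smul g⁻¹).measurableEmbedding, lintegral_indicator hK]
  exact hs.2

theorem MemL2.translate_univ (g : G) {s : ∀ x, E x} (hs : MemL2 F E μ s) :
    MemL2 F E μ (ρ.translate univ g s) :=
  (hs.restrict univ).translate ρ MeasurableSet.univ g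

variable [IsContinuousRiemannianBundle F E]

variable {ι : Type*} (b : HilbertBasis ι ℝ (L2 F E (μ.restrict K)))

theorem rep_translatedBasis (hK : MeasurableSet K) (g : G) (i : ι) :
    ∀ᵐ x ∂μ, (translatedBasis ρ b g i).rep x = ρ.translate K g (b i).rep x :=
  L2.rep_ofSection ((L2.memL2_rep (b i)).translate ρ hK g)

theorem orthonormal_translatedBasis (hK : IsFundamentalPiece G K) :
    Orthonormal ℝ fun p : G × ι => translatedBasis ρ b p.1 p.2 := by
  classical
  rw [orthonormal_iff_ite]
  rintro ⟨g, i⟩ ⟨h, j⟩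
  have hmem := fun (g : G) (i : ι) => (L2.memL2_rep (b i)).translate ρ hK.measurableSet g
  rw [translatedBasis, translatedBasis, L2.inner_ofSection (hmem g i) (hmem h j)]
  by_cases hgh : g = h
  · subst hgh
    rw [ρ.integral_inner_translate hK.measurableSet, ← L2.inner_eq_integral,
      orthonormal_iff_ite.1 b.orthonormal]
    simp
  · rw [if_neg (by simp [hgh])]
    refine (integral_congr_ae (Filter.Eventually.of_forall fun x => ?_)).trans
      (integral_zero M ℝ)
    by_cases hg : g⁻¹ • x ∈ K
    · by_cases hh : h⁻¹ • x ∈ K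
      · exact absurd ((hK.existsUnique_mem x).unique (mem_image_smul_iff.2 hg)
          (mem_image_smul_iff.2 hh)) hgh
      · simp [ρ.translate_of_notMem hh]
    · simp [ρ.translate_of_notMem hg]

/-- Completeness of the translated basis: the coefficients of `u` determine its pullback to `K` by
each `g`, and the countably many sets `gK` cover `M`. -/
theorem eq_zero_of_inner_translatedBasis_eq_zero [Countable G] (hK : IsFundamentalPiece G K)
    {u : L2 F E μ} (hu : ∀ g i, inner ℝ (translatedBasis ρ b g i) u = 0) : u = 0 := by
  have hKm := hK.measurableSet
  have hloc : ∀ g : G, ∀ᵐ x ∂μ, g⁻¹ • x ∈ K → u.rep x = 0 := by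
    intro g
    set v := ρ.translate univ g⁻¹ u.rep with hv
    have hvK : MemL2 F E (μ.restrict K) v := (u.memL2_rep.translate_univ ρ g⁻¹).restrict K
    have hzero : L2.ofSection F (μ.restrict K) v = 0 := by
      have hcoeff : ∀ i, inner ℝ (b i) (L2.ofSection F (μ.restrict K) v) = 0 := by
        intro i
        have h1 : inner ℝ (b i) (L2.ofSection F (μ.restrict K) v) =
            ∫ x, (inner ℝ (ρ.translate K g (b i).rep x) (ρ.translate K g v x) : ℝ) ∂μ := by
          conv_lhs => rw [← L2.ofSection_rep (b i)]
          rw [L2.inner_ofSection (L2.memL2_rep _) hvK, ρ.integral_inner_translate hKm]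
        rw [h1, ← hu g i]
        conv_rhs => rw [← L2.ofSection_rep u]
        rw [translatedBasis,
          L2.inner_ofSection ((L2.memL2_rep (b i)).translate ρ hKm g) u.memL2_rep]
        refine integral_congr_ae (Filter.Eventually.of_forall fun x => ?_)
        exact ρ.inner_translate_translate_inv g _ _ x
      have h2 := hasSum_sq_inner_hilbertBasis b (L2.ofSection F (μ.restrict K) v)
      simp only [hcoeff, ne_eq, OfNat.ofNat_ne_zero, not_false_eq_true, zero_pow] at h2
      exact norm_eq_zero.1 ((pow_eq_zero_iff two_ne_zero).1 (h2.unique hasSum_zero))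
    rw [L2.ofSection_eq_zero_iff hvK] at hzero
    have h1 : ∀ᵐ y ∂μ, y ∈ K → v y = 0 := (ae_restrict_iff' hKm).1 hzero
    have h2 := (measurePreserving_smul g⁻¹ μ).quasiMeasurePreserving.ae h1
    filter_upwards [h2] with x hx hxK
    rw [← ρ.translate_translate_inv hxK u.rep, ρ.translate_of_mem hxK, ← hv, hx hxK, map_zero]
  rw [← L2.ofSection_rep u, L2.ofSection_eq_zero_iff u.memL2_rep]
  filter_upwards [ae_all_iff.2 hloc] with x hx
  obtain ⟨g, hg, -⟩ := hK.existsUnique_mem x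
  exact hx g (mem_image_smul_iff.1 hg)

/-- The translates `e_i^g` of an orthonormal basis of `L²(E|_K)` form an orthonormal basis of
`L²(E)`. -/
noncomputable def translatedHilbertBasis [SigmaFinite μ] [Countable G]
    (hK : IsFundamentalPiece G K) : HilbertBasis (G × ι) ℝ (L2 F E μ) :=
  HilbertBasis.mkOfOrthogonalEqBot (orthonormal_translatedBasis ρ b hK) <| by
    rw [Submodule.eq_bot_iff]
    intro u hu
    refine eq_zero_of_inner_translatedBasis_eq_zero ρ b hK fun g i => ?_
    exact (Submodule.mem_orthogonal _ _).1 hu _ (Submodule.subset_span ⟨(g, i), rfl⟩)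

theorem translatedHilbertBasis_apply [SigmaFinite μ] [Countable G]
    (hK : IsFundamentalPiece G K) (g : G) (i : ι) :
    translatedHilbertBasis ρ b hK (g, i) = translatedBasis ρ b g i := by
  rw [translatedHilbertBasis, HilbertBasis.coe_mkOfOrthogonalEqBot]

end Translate

/-! ### Hilbert-Schmidt bounds for integral operators -/

section Auxiliary

/-- A family of `w i` in a space of dimension `m`, whose synthesis operator `c ↦ ∑ c i • w i` has
squared norm at most `Q`, has `∑ ‖w i‖² ≤ m * Q`. -/
theorem sum_norm_sq_le_finrank_mul {V ι : Type*} [NormedAddCommGroup V] [InnerProductSpace ℝ V]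
    [FiniteDimensional ℝ V] (s : Finset ι) (w : ι → V) {Q : ℝ} (hQ : 0 ≤ Q)
    (h : ∀ c : ι → ℝ, ‖∑ i ∈ s, c i • w i‖ ^ 2 ≤ Q * ∑ i ∈ s, c i ^ 2) :
    ∑ i ∈ s, ‖w i‖ ^ 2 ≤ Module.finrank ℝ V * Q := by
  let v := stdOrthonormalBasis ℝ V
  have hcoord : ∀ k, ∑ i ∈ s, (inner ℝ (v k) (w i) : ℝ) ^ 2 ≤ Q := by
    intro k
    set S := ∑ i ∈ s, (inner ℝ (v k) (w i) : ℝ) ^ 2 with hS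
    have hS0 : 0 ≤ S := Finset.sum_nonneg fun i _ => sq_nonneg _
    have h1 : S = inner ℝ (v k) (∑ i ∈ s, (inner ℝ (v k) (w i) : ℝ) • w i) := by
      rw [inner_sum]
      exact Finset.sum_congr rfl fun i _ => by rw [real_inner_smul_right, sq]
    have h2 : S ≤ ‖∑ i ∈ s, (inner ℝ (v k) (w i) : ℝ) • w i‖ := by
      calc S ≤ ‖v k‖ * ‖∑ i ∈ s, (inner ℝ (v k) (w i) : ℝ) • w i‖ := by
            rw [h1]; exact real_inner_le_norm _ _
        _ = _ := by rw [v.orthonormal.1 k, one_mul]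
    have h3 : S ^ 2 ≤ Q * S := (pow_le_pow_left₀ hS0 h2 2).trans (h _)
    rcases hS0.eq_or_lt with h0 | h0
    · rw [← h0]; exact hQ
    · nlinarith
  calc ∑ i ∈ s, ‖w i‖ ^ 2 = ∑ i ∈ s, ∑ k, (inner ℝ (v k) (w i) : ℝ) ^ 2 := by
        refine Finset.sum_congr rfl fun i _ => ?_
        rw [← v.sum_sq_norm_inner_right (w i)]
        simp
    _ = ∑ k, ∑ i ∈ s, (inner ℝ (v k) (w i) : ℝ) ^ 2 := Finset.sum_comm
    _ ≤ ∑ _k : Fin (Module.finrank ℝ V), Q := Finset.sum_le_sum fun k _ => hcoord k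
    _ = _ := by simp

/-- The Cauchy-Schwarz inequality on a set of finite measure. -/
theorem sq_setIntegral_le {X : Type*} [MeasurableSpace X] {μ : Measure X} {f : X → ℝ}
    (hf0 : ∀ x, 0 ≤ f x) (hf : MemLp f 2 μ) {S : Set X} (hS : μ S ≠ ⊤) :
    (∫ x in S, f x ∂μ) ^ 2 ≤ μ.real S * ∫ x, f x ^ 2 ∂μ := by
  have : IsFiniteMeasure (μ.restrict S) := ⟨by simpa using hS.lt_top⟩
  have h1 := integral_mul_le_Lp_mul_Lq_of_nonneg (μ := μ.restrict S) (p := 2) (q := 2)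
    (by constructor <;> norm_num) (f := fun _ => (1 : ℝ)) (g := f)
    (Filter.Eventually.of_forall fun _ => zero_le_one) (Filter.Eventually.of_forall hf0)
    (memLp_const 1) (by simpa using hf.restrict S)
  have h2 : 0 ≤ ∫ x in S, f x ^ 2 ∂μ := integral_nonneg fun x => sq_nonneg _
  simp only [one_mul, one_pow, integral_const, smul_eq_mul, mul_one, Real.rpow_ofNat,
    ← Real.sqrt_eq_rpow, measureReal_restrict_apply_univ] at h1
  have h3 := pow_le_pow_left₀ (integral_nonneg hf0) h1 2
  rw [mul_pow, Real.sq_sqrt measureReal_nonneg, Real.sq_sqrt h2] at h3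
  refine h3.trans (mul_le_mul_of_nonneg_left ?_ measureReal_nonneg)
  exact setIntegral_le_integral hf.integrable_sq (Filter.Eventually.of_forall fun x => sq_nonneg _)

end Auxiliary

section Kernel

variable {G : Type*} [Group G] {M : Type*} [MulAction G M]
  {n : ℕ} [MetricSpace M] [ChartedSpace (EuclideanSpace ℝ (Fin n)) M]
  {F : Type*} [NormedAddCommGroup F] [NormedSpace ℝ F]
  {E : M → Type*} [TopologicalSpace (TotalSpace F E)] [∀ x, NormedAddCommGroup (E x)]
  [∀ x, InnerProductSpace ℝ (E x)] [FiberBundle F E]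
  (ρ : EquivariantStructure G n F E)
  [MeasurableSpace M] [BorelSpace M] [SecondCountableTopology M] [VectorBundle ℝ F E]
  [FiniteDimensional ℝ F] [IsContinuousRiemannianBundle F E]
  [ContinuousConstSMul G M] {μ : Measure M} [SMulInvariantMeasure G M μ] {K : Set M}
  {ι : Type*} (b : HilbertBasis ι ℝ (L2 F E (μ.restrict K)))

/-- Bessel's inequality for the orthonormal family `e_i^g` in `L²(E|_{gK})`. -/
theorem sum_sq_inner_translatedBasis_le (hK : IsFundamentalPiece G K) (g : G) (t : Finset ι)
    (u : L2 F E μ) :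
    ∑ j ∈ t, (inner ℝ (translatedBasis ρ b g j) u : ℝ) ^ 2 ≤
      ∫ x in (fun x => g⁻¹ • x) ⁻¹' K, ‖u.rep x‖ ^ 2 ∂μ := by
  have hKm := hK.measurableSet
  set v := ρ.translate univ g⁻¹ u.rep with hv
  have hvK : MemL2 F E μ (ρ.translate K g v) :=
    ((u.memL2_rep.translate_univ ρ g⁻¹).restrict K).translate ρ hKm g
  -- only the restriction `translate K g v` of `u` to `gK` enters the coefficients
  have h1 : ∀ j, (inner ℝ (translatedBasis ρ b g j) u : ℝ) =
      inner ℝ (translatedBasis ρ b g j) (L2.ofSection F μ (ρ.translate K g v)) := by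
    intro j
    conv_lhs => rw [← L2.ofSection_rep u]
    have hm := (L2.memL2_rep (b j)).translate ρ hKm g
    rw [translatedBasis, L2.inner_ofSection hm u.memL2_rep, L2.inner_ofSection hm hvK]
    refine integral_congr_ae (Filter.Eventually.of_forall fun x => ?_)
    exact (ρ.inner_translate_translate_inv g _ _ x).symm
  have h2 : ‖L2.ofSection F μ (ρ.translate K g v)‖ ^ 2 =
      ∫ x in (fun x => g⁻¹ • x) ⁻¹' K, ‖u.rep x‖ ^ 2 ∂μ := by
    rw [L2.norm_sq_ofSection hvK, ← integral_indicator (measurable_const_smul g⁻¹ hKm)]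
    refine integral_congr_ae (Filter.Eventually.of_forall fun x => ?_)
    by_cases hx : g⁻¹ • x ∈ K
    · simp only [hv, ρ.translate_translate_inv hx]
      rw [indicator_of_mem (mem_preimage.2 hx)]
    · simp only [ρ.translate_of_notMem hx]
      rw [indicator_of_notMem (mt mem_preimage.1 hx), norm_zero, zero_pow two_ne_zero]
  have h3 := ((orthonormal_translatedBasis ρ b hK).comp (fun j : ι => (g, j))
    (Prod.mk_right_injective g)).sum_inner_products_le (s := t)
    (L2.ofSection F μ (ρ.translate K g v))
  simp only [h1]
  rw [← h2]
  simpa using h3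

/-- The pointwise bound behind the Hilbert-Schmidt estimate: for almost every `x`, the map
`u ↦ (A u)(x) = ∫ k(x,y) u(y)` on `L²(E|_{gK})` has norm at most `q * μ(K)^(1/2)`, by the
Cauchy-Schwarz inequality, and values in a space of dimension `finrank F`. -/
theorem ae_sum_norm_sq_rep_le (hK : IsFundamentalPiece G K) (hfin : μ K ≠ ⊤)
    {A : L2 F E μ →L[ℝ] L2 F E μ} {k : ∀ x y : M, E y →L[ℝ] E x} (hA : IsRepresentedBy A k)
    {g h : G} {q : ℝ}
    (hk : ∀ x y, h⁻¹ • x ∈ K → g⁻¹ • y ∈ K → ‖k x y‖ ≤ q) (s : Finset ι) :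
    ∀ᵐ x ∂μ, h⁻¹ • x ∈ K → ∑ i ∈ s, ‖(A (translatedBasis ρ b g i)).rep x‖ ^ 2 ≤
      Module.finrank ℝ F * (q ^ 2 * μ.real K) := by
  have hKm := hK.measurableSet
  set e : ι → L2 F E μ := fun i => translatedBasis ρ b g i with he
  set gK := (fun x : M => g⁻¹ • x) ⁻¹' K with hgK
  have hgKm : MeasurableSet gK := measurable_const_smul g⁻¹ hKm
  have hgKμ : μ gK = μ K := (measurePreserving_smul g⁻¹ μ).measure_preimage hKm.nullMeasurableSet
  filter_upwards [s.eventually_all.2 fun i _ => hA (e i)] with x hx hxK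
  have : FiniteDimensional ℝ (E x) := finiteDimensional_fiber F x
  rw [← finrank_fiber F (E := E) x]
  refine sum_norm_sq_le_finrank_mul s _ (by positivity) fun c => ?_
  -- `W` ranges over the combinations of the `e_i^g`; it is supported in `gK`
  set W : L2 F E μ := ∑ i ∈ s, c i • e i with hW
  have hWn : ‖W‖ ^ 2 = ∑ i ∈ s, c i ^ 2 := by
    have horth := (orthonormal_translatedBasis ρ b hK).comp (fun j : ι => (g, j))
      (Prod.mk_right_injective g)
    rw [← real_inner_self_eq_norm_sq, hW]
    have := horth.inner_sum c c s
    simpa [sq] using this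
  have hWrep : ∀ᵐ y ∂μ, W.rep y = ∑ i ∈ s, c i • (e i).rep y := by
    filter_upwards [L2.rep_sum s fun i => c i • e i,
      s.eventually_all.2 fun i _ => L2.rep_smul (c i) (e i)] with y h1 h2
    rw [hW, h1]
    exact Finset.sum_congr rfl fun i hi => h2 i hi
  have hWsupp : ∀ᵐ y ∂μ, y ∉ gK → W.rep y = 0 := by
    filter_upwards [hWrep, s.eventually_all.2 fun i _ => rep_translatedBasis ρ b hKm g i]
      with y h1 h2 hy
    rw [h1]
    refine Finset.sum_eq_zero fun i hi => ?_
    rw [he, h2 i hi, ρ.translate_of_notMem hy, smul_zero]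
  have hint : ∑ i ∈ s, c i • (A (e i)).rep x = ∫ y, k x y (W.rep y) ∂μ := by
    have h1 : ∑ i ∈ s, c i • (A (e i)).rep x = ∑ i ∈ s, ∫ y, c i • k x y ((e i).rep y) ∂μ := by
      refine Finset.sum_congr rfl fun i hi => ?_
      rw [(hx i hi).2, integral_smul]
    rw [h1]
    refine (integral_finsetSum s (f := fun i y => c i • k x y ((e i).rep y))
      fun i hi => (hx i hi).1.smul (c i)).symm.trans (integral_congr_ae ?_)
    filter_upwards [hWrep] with y hy
    rw [hy, map_sum]
    simp only [map_smul]
  have hnorm : Integrable (fun y => ‖W.rep y‖) (μ.restrict gK) := by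
    have : IsFiniteMeasure (μ.restrict gK) := ⟨by simpa [hgKμ] using hfin.lt_top⟩
    exact (W.memL2_rep.memLp_norm.restrict gK).integrable one_le_two
  have hle : ‖∫ y, k x y (W.rep y) ∂μ‖ ≤ q * ∫ y in gK, ‖W.rep y‖ ∂μ := by
    rw [← integral_const_mul, ← integral_indicator hgKm]
    refine norm_integral_le_of_norm_le ((integrable_indicator_iff hgKm).2 (hnorm.const_mul q)) ?_
    filter_upwards [hWsupp] with y hy
    by_cases hyK : y ∈ gK
    · rw [indicator_of_mem hyK]
      exact ((k x y).le_opNorm _).trans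
        (mul_le_mul_of_nonneg_right (hk x y hxK hyK) (norm_nonneg _))
    · rw [indicator_of_notMem hyK, hy hyK, map_zero, norm_zero]
  have hcs := sq_setIntegral_le (fun y => norm_nonneg _) W.memL2_rep.memLp_norm
    (S := gK) (by rwa [hgKμ])
  rw [← L2.norm_sq_eq_integral, hWn, measureReal_def, hgKμ, ← measureReal_def] at hcs
  change ‖∑ i ∈ s, c i • (A (e i)).rep x‖ ^ 2 ≤ _
  rw [hint]
  calc ‖∫ y, k x y (W.rep y) ∂μ‖ ^ 2 ≤ (q * ∫ y in gK, ‖W.rep y‖ ∂μ) ^ 2 :=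
        pow_le_pow_left₀ (norm_nonneg _) hle 2
    _ = q ^ 2 * (∫ y in gK, ‖W.rep y‖ ∂μ) ^ 2 := mul_pow _ _ _
    _ ≤ q ^ 2 * (μ.real K * ∑ i ∈ s, c i ^ 2) := by gcongr
    _ = _ := by ring

/-- An integral operator whose kernel is bounded by `q` on `hK × gK` has a block from `gK` to `hK`
of squared Hilbert-Schmidt norm at most `finrank F * (q * μ(K))²`. -/
theorem sum_sq_inner_translatedBasis_map_le (hK : IsFundamentalPiece G K) (hfin : μ K ≠ ⊤)
    {A : L2 F E μ →L[ℝ] L2 F E μ} {k : ∀ x y : M, E y →L[ℝ] E x} (hA : IsRepresentedBy A k)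
    {g h : G} {q : ℝ}
    (hk : ∀ x y, h⁻¹ • x ∈ K → g⁻¹ • y ∈ K → ‖k x y‖ ≤ q) (s t : Finset ι) :
    ∑ j ∈ t, ∑ i ∈ s,
        (inner ℝ (translatedBasis ρ b h j) (A (translatedBasis ρ b g i)) : ℝ) ^ 2 ≤
      Module.finrank ℝ F * (q * μ.real K) ^ 2 := by
  have hKm := hK.measurableSet
  set hK' := (fun x : M => h⁻¹ • x) ⁻¹' K with hhK
  have hhKm : MeasurableSet hK' := measurable_const_smul h⁻¹ hKm
  have hhKμ : μ hK' = μ K := (measurePreserving_smul h⁻¹ μ).measure_preimage hKm.nullMeasurableSet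
  have : IsFiniteMeasure (μ.restrict hK') := ⟨by simpa [hhKμ] using hfin.lt_top⟩
  rw [Finset.sum_comm]
  calc ∑ i ∈ s, ∑ j ∈ t,
        (inner ℝ (translatedBasis ρ b h j) (A (translatedBasis ρ b g i)) : ℝ) ^ 2
      ≤ ∑ i ∈ s, ∫ x in hK', ‖(A (translatedBasis ρ b g i)).rep x‖ ^ 2 ∂μ :=
        Finset.sum_le_sum fun i _ => sum_sq_inner_translatedBasis_le ρ b hK h t _
    _ = ∫ x in hK', ∑ i ∈ s, ‖(A (translatedBasis ρ b g i)).rep x‖ ^ 2 ∂μ :=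
        (integral_finsetSum s fun i _ => (L2.memL2_rep _).integrable_norm_sq.restrict).symm
    _ ≤ ∫ _x in hK', Module.finrank ℝ F * (q ^ 2 * μ.real K) ∂μ := by
        refine integral_mono_ae (integrable_finsetSum s fun i _ =>
          (L2.memL2_rep _).integrable_norm_sq.restrict) (integrable_const _) ?_
        exact (ae_restrict_iff' hhKm).2 (ae_sum_norm_sq_rep_le ρ b hK hfin hA hk s)
    _ = Module.finrank ℝ F * (q * μ.real K) ^ 2 := by
        rw [integral_const, measureReal_restrict_apply_univ, measureReal_def, hhKμ,
          ← measureReal_def, smul_eq_mul]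
        ring

end Kernel

/-! ### Piecewise traces of products -/

section PiecewiseTraceOfBlocks

variable {n : ℕ} {M : Type*} [TopologicalSpace M] [ChartedSpace (EuclideanSpace ℝ (Fin n)) M]
  [SecondCountableTopology M] [MeasurableSpace M] [BorelSpace M]
  {G : Type*} [Group G] [MulAction G M]
  {F : Type*} [NormedAddCommGroup F] [NormedSpace ℝ F] [FiniteDimensional ℝ F]
  {E : M → Type*} [TopologicalSpace (TotalSpace F E)] [∀ x, NormedAddCommGroup (E x)]
  [∀ x, InnerProductSpace ℝ (E x)] [FiberBundle F E] [VectorBundle ℝ F E]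
  [IsContinuousRiemannianBundle F E]
  {μ : Measure M} {ρ : EquivariantStructure G n F E} {K : Set M}
  {ι : Type*} {b : HilbertBasis ι ℝ (L2 F E (μ.restrict K))}

/-- The piecewise trace of `A` at `g` is the sum of the diagonal matrix coefficients of `A` over
`gK`, for every decomposition used to compute it. -/
theorem HasPiecewiseTrace.hasSum {A : L2 F E μ →L[ℝ] L2 F E μ} {τ : lp (fun _ : G => ℝ) ⊤}
    (h : HasPiecewiseTrace ρ b A τ) (g : G) :
    HasSum (fun i => (inner ℝ (translatedBasis ρ b g i) (A (translatedBasis ρ b g i)) : ℝ))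
      (τ g) := by
  obtain ⟨B, C, -, -, hBC, hsum⟩ := h
  simpa only [hBC] using hsum g

variable [ContinuousConstSMul G M] [Countable G] [SMulInvariantMeasure G M μ] [SigmaFinite μ]
  {hK : IsFundamentalPiece G K} {β : G → ℝ} {A B : L2 F E μ →L[ℝ] L2 F E μ}

theorem BlockBound.isPiecewiseHilbertSchmidt
    (hA : BlockBound (translatedHilbertBasis ρ b hK) β A) (hβ : Summable β) :
    IsPiecewiseHilbertSchmidt ρ b A := by
  refine ⟨fun g => ?_, Real.sqrt (∑' h, β h), fun g => ?_⟩
  · simpa only [translatedHilbertBasis_apply] using hA.summable_norm_sq hβ g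
  · have := hA.tsum_norm_sq_le hβ g
    simp only [translatedHilbertBasis_apply] at this
    exact Real.sqrt_le_sqrt this

theorem HasPiecewiseTrace.eq_tsum_blockTrace
    (hA : BlockBound (translatedHilbertBasis ρ b hK) β A)
    (hB : BlockBound (translatedHilbertBasis ρ b hK) β B) (hβ : Summable β)
    (hsymm : ∀ g, β g⁻¹ = β g) {τ : lp (fun _ : G => ℝ) ⊤}
    (h : HasPiecewiseTrace ρ b (A ∘L B) τ) (g : G) :
    τ g = ∑' h, blockTrace (translatedHilbertBasis ρ b hK) A B g h := by
  have h1 := hasSum_inner_comp hA hB hβ hsymm g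
  simp only [translatedHilbertBasis_apply] at h1
  exact (h.hasSum g).unique h1

/-- The decomposition `A ∘ B = (A†)† ∘ B` exhibits `A ∘ B` as piecewise trace-class. -/
theorem BlockBound.exists_hasPiecewiseTrace
    (hA : BlockBound (translatedHilbertBasis ρ b hK) β A)
    (hB : BlockBound (translatedHilbertBasis ρ b hK) β B) (hβ : Summable β)
    (hsymm : ∀ g, β g⁻¹ = β g) : ∃ τ, HasPiecewiseTrace ρ b (A ∘L B) τ := by
  set e := translatedHilbertBasis ρ b hK with he
  have hbound : ∀ g, ‖∑' h, blockTrace e A B g h‖ ≤ ∑' h, β h := by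
    intro g
    have h1 : HasSum (fun h => β (g⁻¹ * h)) (∑' h, β h) :=
      (Equiv.mulLeft g⁻¹).hasSum_iff.2 hβ.hasSum
    exact tsum_of_norm_bounded h1 fun h => abs_blockTrace_le hA hB hsymm g h
  refine ⟨⟨fun g => ∑' h, blockTrace e A B g h,
    memℓp_infty ⟨∑' h, β h, by rintro _ ⟨g, rfl⟩; exact hbound g⟩⟩,
    ContinuousLinearMap.adjoint A, B, (hA.adjoint hsymm).isPiecewiseHilbertSchmidt hβ,
    hB.isPiecewiseHilbertSchmidt hβ, fun u v => ?_, fun g => ?_⟩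
  · rw [ContinuousLinearMap.adjoint_inner_left]; rfl
  · have h1 := hasSum_inner_comp hA hB hβ hsymm g
    simp only [he, translatedHilbertBasis_apply] at h1
    simp only [ContinuousLinearMap.adjoint_inner_left]
    exact h1

theorem BlockBound.sub_mem_closure (hA : BlockBound (translatedHilbertBasis ρ b hK) β A)
    (hB : BlockBound (translatedHilbertBasis ρ b hK) β B) (hβ : Summable β)
    (hsymm : ∀ g, β g⁻¹ = β g) {τ₁ τ₂ : lp (fun _ : G => ℝ) ⊤}
    (h₁ : HasPiecewiseTrace ρ b (A ∘L B) τ₁) (h₂ : HasPiecewiseTrace ρ b (B ∘L A) τ₂) :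
    τ₁ - τ₂ ∈ (coinvariantSubspace G).topologicalClosure := by
  refine sub_mem_closure_coinvariantSubspace hβ (abs_blockTrace_le hA hB hsymm)
    (h₁.eq_tsum_blockTrace hA hB hβ hsymm) fun g => ?_
  rw [h₂.eq_tsum_blockTrace hB hA hβ hsymm g]
  exact tsum_congr fun h => blockTrace_comm _ B A g h

end PiecewiseTraceOfBlocks

section GaussianBlocks

variable {G : Type*} [Group G] {M : Type*} [MulAction G M]
  {n : ℕ} [MetricSpace M] [ChartedSpace (EuclideanSpace ℝ (Fin n)) M]
  {F : Type*} [NormedAddCommGroup F] [NormedSpace ℝ F]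
  {E : M → Type*} [TopologicalSpace (TotalSpace F E)] [∀ x, NormedAddCommGroup (E x)]
  [∀ x, InnerProductSpace ℝ (E x)] [FiberBundle F E]
  (ρ : EquivariantStructure G n F E)
  [MeasurableSpace M] [BorelSpace M] [SecondCountableTopology M] [VectorBundle ℝ F E]
  [FiniteDimensional ℝ F] [IsContinuousRiemannianBundle F E] [Countable G]
  [ContinuousConstSMul G M] {μ : Measure M} [SMulInvariantMeasure G M μ] [SigmaFinite μ]
  {K : Set M} {ι : Type*} (b : HilbertBasis ι ℝ (L2 F E (μ.restrict K)))

/-- Operators with Gaussian propagation have blocks with summable Hilbert-Schmidt norms. Only the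
Gaussian bound on the kernel is needed, not its smoothness. -/
theorem HasGaussianPropagation.exists_blockBound (hK : IsFundamentalPiece G K) (hfin : μ K ≠ ⊤)
    (hgauss : ∀ c : ℝ, 0 < c → ∃ β : G → ℝ, Summable β ∧ (∀ g, 0 ≤ β g) ∧
      ∀ g h : G, ∀ x ∈ K, ∀ y ∈ K, Real.exp (-c * dist (h • x) (g • y) ^ 2) ≤ β (h⁻¹ * g))
    {A : L2 F E μ →L[ℝ] L2 F E μ} (hA : HasGaussianPropagation n A) :
    ∃ β : G → ℝ, Summable β ∧ (∀ g, 0 ≤ β g) ∧ BlockBound (translatedHilbertBasis ρ b hK) β A := by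
  obtain ⟨k, -, hrep, C₁, C₂, hC₁, hC₂, hk⟩ := hA
  obtain ⟨β, hβ, hβ0, hle⟩ := hgauss (2 * C₂) (by positivity)
  refine ⟨fun g => Module.finrank ℝ F * (C₁ ^ 2 * β g * μ.real K ^ 2), ?_, fun g => ?_, ?_⟩
  · exact ((hβ.mul_left _).mul_right _).mul_left _
  · have := hβ0 g
    positivity
  · intro g h s t
    simp only [translatedHilbertBasis_apply]
    refine (sum_sq_inner_translatedBasis_map_le ρ b hK hfin hrep (g := g) (h := h)
      (q := C₁ * Real.sqrt (β (h⁻¹ * g))) (fun x y hx hy => ?_) s t).trans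
      (le_of_eq ?_)
    · refine (hk x y).trans (mul_le_mul_of_nonneg_left (Real.le_sqrt_of_sq_le ?_) hC₁.le)
      have h1 := hle g h _ hx _ hy
      rw [smul_inv_smul, smul_inv_smul] at h1
      refine le_trans (le_of_eq ?_) h1
      rw [← Real.exp_nat_mul]
      push_cast
      ring_nf
    · rw [mul_pow, mul_pow, Real.sq_sqrt (hβ0 _)]

end GaussianBlocks

end PiecewiseTrace
theorem proposition3 {n : ℕ} {M : Type*} [MetricSpace M]
    [ChartedSpace (EuclideanSpace ℝ (Fin n)) M] [IsManifold (𝓡 n) ∞ M] [ConnectedSpace M]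
    [SecondCountableTopology M] [MeasurableSpace M] [BorelSpace M]
    [RiemannianBundle (fun x : M => TangentSpace (𝓡 n) x)]
    [IsContMDiffRiemannianBundle (𝓡 n) ∞ (EuclideanSpace ℝ (Fin n))
      (fun x : M => TangentSpace (𝓡 n) x)]
    [IsRiemannianManifold (𝓡 n) M]
    {G : Type*} [Group G] [MulAction G M] [ProperlyDiscontinuousSMul G M]
    [CompactSpace (MulAction.orbitRel.Quotient G M)]
    (hfree : ∀ (g : G) (x : M), g • x = x → g = 1)
    (hsmooth : ∀ g : G, ContMDiff (𝓡 n) (𝓡 n) ∞ (fun x : M => g • x))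
    (hisom : ∀ (g : G) (x : M) (v w : TangentSpace (𝓡 n) x),
      inner ℝ (mfderiv (𝓡 n) (𝓡 n) (fun y : M => g • y) x v)
        (mfderiv (𝓡 n) (𝓡 n) (fun y : M => g • y) x w) = inner ℝ v w)
    {F : Type*} [NormedAddCommGroup F] [NormedSpace ℝ F] [FiniteDimensional ℝ F]
    {E : M → Type*} [TopologicalSpace (TotalSpace F E)] [∀ x, NormedAddCommGroup (E x)]
    [∀ x, InnerProductSpace ℝ (E x)] [FiberBundle F E] [VectorBundle ℝ F E]
    [ContMDiffVectorBundle ∞ F E (𝓡 n)] [IsContinuousRiemannianBundle F E]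
    [IsContMDiffRiemannianBundle (𝓡 n) ∞ F E]
    (ρ : EquivariantStructure G n F E)
    {K : Set M} (hK : IsFundamentalPiece G K)
    {ι : Type*} (b : HilbertBasis ι ℝ (L2 F E ((riemannianVolume n M).restrict K)))
    (A B : L2 F E (riemannianVolume n M) →L[ℝ] L2 F E (riemannianVolume n M))
    (hA : HasGaussianPropagation n A) (hB : HasGaussianPropagation n B) :
    (∃ τ, HasPiecewiseTrace ρ b (A ∘L B) τ) ∧ (∃ τ, HasPiecewiseTrace ρ b (B ∘L A) τ) ∧
      ∀ τ₁ τ₂ : lp (fun _ : G => ℝ) ⊤, HasPiecewiseTrace ρ b (A ∘L B) τ₁ →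
        HasPiecewiseTrace ρ b (B ∘L A) τ₂ →
          τ₁ - τ₂ ∈ (coinvariantSubspace G).topologicalClosure := by
  have hcs : ContinuousConstSMul G M := ⟨fun g => (hsmooth g).continuous⟩
  have hdist_le : ∀ (g : G) (x y : M), edist (g • x) (g • y) ≤ edist x y := fun g =>
    edist_map_le (hsmooth g) (hisom g)
  have hdist : ∀ (g : G) (x y : M), dist (g • x) (g • y) = dist x y := by
    intro g x y
    rw [dist_edist, dist_edist]
    congr 1
    refine le_antisymm (hdist_le g x y) ?_
    simpa using hdist_le g⁻¹ (g • x) (g • y)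
  have hloc : LocallyCompactSpace M := Manifold.locallyCompact_of_finiteDimensional (𝓡 n)
  have hgauss := fun (c : ℝ) (hc : 0 < c) => hK.exists_summable_gaussian_bound
    (fun x y a b ha hb h => exists_dist_lt_dist_lt n ha hb h) hdist hc
  -- a summable function with positive values lives on a countable set
  have hcount : Countable G := by
    obtain ⟨β, hβ, -, hle⟩ := hgauss 1 one_pos
    obtain ⟨x⟩ : Nonempty M := inferInstance
    obtain ⟨g₀, ⟨y, hy, -⟩, -⟩ := hK.existsUnique_mem x
    refine Set.countable_univ_iff.1 (hβ.countable_support.mono fun g _ => ?_)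
    have h1 := (Real.exp_pos _).trans_le (hle g 1 y hy y hy)
    rw [inv_one, one_mul] at h1
    exact h1.ne'
  have hlf : IsLocallyFiniteMeasure (riemannianVolume n M) :=
    isLocallyFiniteMeasure_riemannianVolume
  have hinv : SMulInvariantMeasure G M (riemannianVolume n M) := ⟨fun g S hS =>
    (measurePreserving_riemannianVolume (Homeomorph.smul g) (hsmooth g) (hisom g)).measure_preimage
      hS.nullMeasurableSet⟩
  have hfin : riemannianVolume n M K ≠ ⊤ :=
    ((measure_mono subset_closure).trans_lt hK.isCompact_closure.measure_lt_top).ne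
  obtain ⟨β₁, h₁, h₁0, hA'⟩ := hA.exists_blockBound ρ b hK hfin hgauss
  obtain ⟨β₂, h₂, h₂0, hB'⟩ := hB.exists_blockBound ρ b hK hfin hgauss
  -- a common bound for `A` and `B`, symmetric so that it also applies to the adjoints
  set β : G → ℝ := fun g => (β₁ g + β₂ g) + (β₁ g⁻¹ + β₂ g⁻¹) with hβdef
  have hβ : Summable β := (h₁.add h₂).add ((Equiv.inv G).summable_iff.2 (h₁.add h₂))
  have hsymm : ∀ g, β g⁻¹ = β g := fun g => by
    simp only [hβdef, inv_inv]
    ring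
  have hAβ : BlockBound (translatedHilbertBasis ρ b hK) β A := hA'.mono fun g => by
    simp only [hβdef]
    linarith [h₁0 g⁻¹, h₂0 g, h₂0 g⁻¹]
  have hBβ : BlockBound (translatedHilbertBasis ρ b hK) β B := hB'.mono fun g => by
    simp only [hβdef]
    linarith [h₁0 g, h₁0 g⁻¹, h₂0 g⁻¹]
  exact ⟨hAβ.exists_hasPiecewiseTrace hBβ hβ hsymm, hBβ.exists_hasPiecewiseTrace hAβ hβ hsymm,
    fun τ₁ τ₂ hτ₁ hτ₂ => hAβ.sub_mem_closure hBβ hβ hsymm hτ₁ hτ₂⟩
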